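/- Let $R\in \mathrm{End}(\mathbb C^n\otimes\mathbb C^n)$ be an invertible matrix with $R_{12}R_{13}R_{23}=R_{23}R_{13}R_{12}$ and let $B^{ij}_{mn}=R^{ji}_{mn}$. Let $Y_-$ be the complex bialgebra with generators $T=(t^i_j)$, $E=(E_i)$ and $Y_+$ the one with generators $U=(u^i_j)$, $F=(F^i)$, with relations $$R_{12}T_1T_2=T_2T_1R_{12},\quad E_1T_2=T_2E_1R_{12},\qquad R_{12}U_1U_2=U_2U_1R_{12},\quad F_2U_1=R_{12}U_1F_2,$$ and $\Delta(T)=T\hat\otimes T$, $\Delta(E)=E\hat\otimes T+1\hat\otimes E$, $\varepsilon(T)=\mathbf 1$, $\varepsilon(E)=0$, $\Delta(U)=U\hat\otimes U$, $\Delta(F)=F\hat\otimes 1+U\hat\otimes F$, $\varepsilon(U)=\mathbf 1$, $\varepsilon(F)=0$. Let $\langle\,,\rangle:Y_+\otimes Y_-\to\mathbb C$ be the skew pairing, i.e. $\langle xy,a\rangle=\langle x\otimes y,\Delta(a)\rangle$, $\langle x,ba\rangle=\langle\Delta(x),a\otimes b\rangle$, $\langle 1,a\rangle=\varepsilon(a)$,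 $\langle x,1\rangle=\varepsilon(x)$, given on generators by $\langle U,T\rangle=R$, $\langle F^i,E_j\rangle=\delta^i_j$, $\langle U,E\rangle=\langle F,T\rangle=0$. Let $I_-$ be the set of elements of the subalgebra of $Y_-$ generated by $T$ that pair to zero with the subalgebra of $Y_+$ generated by $U$, and define $I_+$ symmetrically. Let $\bar Y_\pm$ be the quotient of $Y_\pm$ by the two-sided ideal generated by $I_\pm$, with the induced pairing, and let $\bar Y_-(T)$, $\bar Y_+(U)$ be the subalgebras of $\bar Y_-$, $\bar Y_+$ generated by the images of $T$ and $U$. The null ideal of $\bar Y_-$ (of $\bar Y_+$) is the set of its elements that pair to zero with all of $\bar Y_+$ (of $\bar Y_-$). For $N\ge 0$ let $V=(\mathbb C^n)^{\otimes N}$ with multi-indices $[\alpha]=(\alpha_1,\dots,\alpha_N)$, $E_{[\alpha]}=E_{\alpha_1}\cdots E_{\alpha_N}$, $F^{[\alpha]}=F^{\alpha_1}\cdots F^{\alpha_N}$, and let $[N!]_B$ be the braided factorial on $V$: with $B_m=B_{m,m+1}$, $[0!]_B=1$ and $[N!]_B=\big(\sum_{k=1}^{N}B_kB_{k+1}\cdots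 B_{N-1}\big)\,([(N-1)!]_B\otimes 1)$. Then: 1. The induced pairing of $\bar Y_+(U)$ and $\bar Y_-(T)$ is non-degenerate. 2. For every $N$ and every $\omega(T)\in V\otimes \bar Y_-(T)$, the element $\omega^{[\alpha]}(T)E_{[\alpha]}$ (summed over $[\alpha]$) lies in the null ideal of $\bar Y_-$ if and only if $[N!]_B\,\omega(T)=0$. 3. The kernel of $[N!]_B$ on $V\otimes\bar Y_-(T)$ is $K\otimes\bar Y_-(T)$, where $K$ is the kernel of $[N!]_B$ on $V$. 4. The two-sided ideal of $\bar Y_-$ generated by all $\omega^{[\alpha]}(T)E_{[\alpha]}$ with $[N!]_B\,\omega(T)=0$ ($N\ge0$) equals the one generated by all $E_{[\alpha]}\omega^{[\alpha]}$ with numerical $\omega\in V$ and $[N!]_B\,\omega=0$ ($N\ge 0$). 5. The null ideal of $\bar Y_-$ is the two-sided ideal generated by all $E_{[\alpha]}\omega^{[\alpha]}$ with numerical $\omega$ and $[N!]_B\,\omega=0$; the null ideal of $\bar Y_+$ is the two-sided ideal generated by all $\eta_{[\alpha]}F^{[\alpha]}$ with numerical $\eta$ and $\eta\,[N!]_B=0$.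 -/

import Mathlib

set_option linter.unusedSimpArgs false
open scoped TensorProduct BigOperators

noncomputable section

namespace YBAlg

/-- A linear map `V^{⊗N} → V^{⊗N}` with `V = ℂⁿ`, in coordinates: rows and columns are multi-indices. -/
abbrev MultiMat (n N : ℕ) := Matrix (Fin N → Fin n) (Fin N → Fin n) ℂ

/-- `onLegs A i j` is `A_{ij}`: the two-leg matrix `A` (entry `A (a,b) (c,d) = A^{ab}_{cd}`) acting on
the legs `i ≠ j` of `V^{⊗N}` and as the identity on all other legs. -/
def onLegs {n N : ℕ} (A : Matrix (Fin n × Fin n) (Fin n × Fin n) ℂ) (i j : Fin N) : MultiMat n N :=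
  fun a b => if ∀ k, k ≠ i → k ≠ j → a k = b k then A (a i, a j) (b i, b j) else 0

/-- The Yang-Baxter equation `R₁₂ R₁₃ R₂₃ = R₂₃ R₁₃ R₁₂`. -/
def YangBaxter {n : ℕ} (R : Matrix (Fin n × Fin n) (Fin n × Fin n) ℂ) : Prop :=
  (onLegs R 0 1 * onLegs R 0 2 * onLegs R 1 2 : MultiMat n 3) =
    onLegs R 1 2 * onLegs R 0 2 * onLegs R 0 1

/-- The braid matrix `B^{ij}_{mn} = R^{ji}_{mn}`. -/
def braid {n : ℕ} (R : Matrix (Fin n × Fin n) (Fin n × Fin n) ℂ) :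
    Matrix (Fin n × Fin n) (Fin n × Fin n) ℂ :=
  fun a b => R (a.2, a.1) b

/-- The braided integer `[N+1]_B = ∑_{k=1}^{N+1} B_k B_{k+1} ⋯ B_N` on `V^{⊗(N+1)}`, where
`B_m = B_{m,m+1}` (the summand `k = N+1` is the empty product `1`). -/
def braidedInt {n : ℕ} (B : Matrix (Fin n × Fin n) (Fin n × Fin n) ℂ) (N : ℕ) :
    MultiMat n (N + 1) :=
  ∑ k : Fin (N + 1),
    (((List.finRange N).drop k).map fun m => (onLegs B m.castSucc m.succ : MultiMat n (N + 1))).prod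

/-- `M ⊗ 1` on `V^{⊗N} ⊗ V`. -/
def tensorId {n N : ℕ} (M : MultiMat n N) : MultiMat n (N + 1) :=
  fun a b => if a (Fin.last N) = b (Fin.last N) then M (Fin.init a) (Fin.init b) else 0

/-- The braided factorial: `[0!]_B = 1`, `[(N+1)!]_B = [N+1]_B ([N!]_B ⊗ 1)`. -/
def braidedFactorial {n : ℕ} (B : Matrix (Fin n × Fin n) (Fin n × Fin n) ℂ) :
    (N : ℕ) → MultiMat n N
  | 0 => 1
  | N + 1 => braidedInt B N * tensorId (braidedFactorial B N)

/-! ### The algebras `Y₋` and `Y₊` -/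

/-- Generators `t^i_j`, `E_i` of `Y₋`. -/
inductive GenMinus (n : ℕ)
  | t (i j : Fin n)
  | E (i : Fin n)

/-- Generators `u^i_j`, `F^i` of `Y₊`. -/
inductive GenPlus (n : ℕ)
  | u (i j : Fin n)
  | F (i : Fin n)

section Algebras

variable {n : ℕ} (R : Matrix (Fin n × Fin n) (Fin n × Fin n) ℂ)

local notation "gen" => FreeAlgebra.ι ℂ

/-- The relations `R₁₂ T₁ T₂ = T₂ T₁ R₁₂` and `E₁ T₂ = T₂ E₁ R₁₂`, in components. -/
inductive RelMinus : FreeAlgebra ℂ (GenMinus n) → FreeAlgebra ℂ (GenMinus n) → Prop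
  | tt (a b c d : Fin n) : RelMinus
      (∑ p, ∑ q, R (a, b) (p, q) • (gen (.t p c) * gen (.t q d)))
      (∑ p, ∑ q, R (p, q) (c, d) • (gen (.t b q) * gen (.t a p)))
  | Et (i k j : Fin n) : RelMinus
      (gen (.E i) * gen (.t k j))
      (∑ p, ∑ l, R (p, l) (i, j) • (gen (.t k l) * gen (.E p)))

/-- The relations `R₁₂ U₁ U₂ = U₂ U₁ R₁₂` and `F₂ U₁ = R₁₂ U₁ F₂`, in components. -/
inductive RelPlus : FreeAlgebra ℂ (GenPlus n) → FreeAlgebra ℂ (GenPlus n) → Prop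
  | uu (a b c d : Fin n) : RelPlus
      (∑ p, ∑ q, R (a, b) (p, q) • (gen (.u p c) * gen (.u q d)))
      (∑ p, ∑ q, R (p, q) (c, d) • (gen (.u b q) * gen (.u a p)))
  | Fu (a b c : Fin n) : RelPlus
      (gen (.F b) * gen (.u a c))
      (∑ p, ∑ q, R (a, b) (p, q) • (gen (.u p c) * gen (.F q)))

/-- The algebra `Y₋`. -/
def YMinus := RingQuot (RelMinus R)
/-- The algebra `Y₊`. -/
def YPlus := RingQuot (RelPlus R)

instance : Ring (YMinus R) := inferInstanceAs (Ring (RingQuot (RelMinus R)))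
instance : Algebra ℂ (YMinus R) := inferInstanceAs (Algebra ℂ (RingQuot (RelMinus R)))
instance : Ring (YPlus R) := inferInstanceAs (Ring (RingQuot (RelPlus R)))
instance : Algebra ℂ (YPlus R) := inferInstanceAs (Algebra ℂ (RingQuot (RelPlus R)))

/-- The quotient map onto `Y₋`. -/
def mkMinus : FreeAlgebra ℂ (GenMinus n) →ₐ[ℂ] YMinus R := RingQuot.mkAlgHom ℂ (RelMinus R)
/-- The quotient map onto `Y₊`. -/
def mkPlus : FreeAlgebra ℂ (GenPlus n) →ₐ[ℂ] YPlus R := RingQuot.mkAlgHom ℂ (RelPlus R)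

/-- The generator `t^i_j` of `Y₋`. -/
def t (i j : Fin n) : YMinus R := mkMinus R (gen (.t i j))
/-- The generator `E_i` of `Y₋`. -/
def E (i : Fin n) : YMinus R := mkMinus R (gen (.E i))
/-- The generator `u^i_j` of `Y₊`. -/
def u (i j : Fin n) : YPlus R := mkPlus R (gen (.u i j))
/-- The generator `F^i` of `Y₊`. -/
def F (i : Fin n) : YPlus R := mkPlus R (gen (.F i))

variable {R}

theorem t_rel (a b c d : Fin n) :
    ∑ p, ∑ q, R (a, b) (p, q) • (t R p c * t R q d) =
      ∑ p, ∑ q, R (p, q) (c, d) • (t R b q * t R a p) := by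
  have h : mkMinus R _ = mkMinus R _ :=
    RingQuot.mkAlgHom_rel ℂ (RelMinus.tt (R := R) a b c d)
  simp only [map_sum, map_smul, map_mul] at h
  exact h

theorem E_rel (i k j : Fin n) :
    E R i * t R k j = ∑ p, ∑ l, R (p, l) (i, j) • (t R k l * E R p) := by
  have h : mkMinus R _ = mkMinus R _ :=
    RingQuot.mkAlgHom_rel ℂ (RelMinus.Et (R := R) i k j)
  simp only [map_sum, map_smul, map_mul] at h
  exact h

theorem u_rel (a b c d : Fin n) :
    ∑ p, ∑ q, R (a, b) (p, q) • (u R p c * u R q d) =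
      ∑ p, ∑ q, R (p, q) (c, d) • (u R b q * u R a p) := by
  have h : mkPlus R _ = mkPlus R _ :=
    RingQuot.mkAlgHom_rel ℂ (RelPlus.uu (R := R) a b c d)
  simp only [map_sum, map_smul, map_mul] at h
  exact h

theorem F_rel (a b c : Fin n) :
    F R b * u R a c = ∑ p, ∑ q, R (a, b) (p, q) • (u R p c * F R q) := by
  have h : mkPlus R _ = mkPlus R _ :=
    RingQuot.mkAlgHom_rel ℂ (RelPlus.Fu (R := R) a b c)
  simp only [map_sum, map_smul, map_mul] at h
  exact h

variable (R)

/-- Algebra maps out of `Y₋`, given on generators. -/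
def liftMinus {A : Type*} [Ring A] [Algebra ℂ A] (ft : Fin n → Fin n → A) (fE : Fin n → A)
    (h1 : ∀ a b c d, ∑ p, ∑ q, R (a, b) (p, q) • (ft p c * ft q d) =
      ∑ p, ∑ q, R (p, q) (c, d) • (ft b q * ft a p))
    (h2 : ∀ i k j, fE i * ft k j = ∑ p, ∑ l, R (p, l) (i, j) • (ft k l * fE p)) :
    YMinus R →ₐ[ℂ] A :=
  RingQuot.liftAlgHom ℂ ⟨FreeAlgebra.lift ℂ fun | .t i j => ft i j | .E i => fE i, by
    intro x y h
    cases h with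
    | tt a b c d => simpa [map_sum] using h1 a b c d
    | Et i k j => simpa [map_sum] using h2 i k j⟩

/-- Algebra maps out of `Y₊`, given on generators. -/
def liftPlus {A : Type*} [Ring A] [Algebra ℂ A] (fu : Fin n → Fin n → A) (fF : Fin n → A)
    (h1 : ∀ a b c d, ∑ p, ∑ q, R (a, b) (p, q) • (fu p c * fu q d) =
      ∑ p, ∑ q, R (p, q) (c, d) • (fu b q * fu a p))
    (h2 : ∀ a b c, fF b * fu a c = ∑ p, ∑ q, R (a, b) (p, q) • (fu p c * fF q)) :
    YPlus R →ₐ[ℂ] A :=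
  RingQuot.liftAlgHom ℂ ⟨FreeAlgebra.lift ℂ fun | .u i j => fu i j | .F i => fF i, by
    intro x y h
    cases h with
    | uu a b c d => simpa [map_sum] using h1 a b c d
    | Fu i k j => simpa [map_sum] using h2 i k j⟩

section lift
variable {R} {A : Type*} [Ring A] [Algebra ℂ A]

@[simp] theorem liftMinus_t (ft : Fin n → Fin n → A) (fE : Fin n → A) (h1) (h2) (i j : Fin n) :
    liftMinus R ft fE h1 h2 (t R i j) = ft i j := by
  simp only [liftMinus, t, mkMinus]
  erw [RingQuot.liftAlgHom_mkAlgHom_apply]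
  simp

@[simp] theorem liftMinus_E (ft : Fin n → Fin n → A) (fE : Fin n → A) (h1) (h2) (i : Fin n) :
    liftMinus R ft fE h1 h2 (E R i) = fE i := by
  simp only [liftMinus, E, mkMinus]
  erw [RingQuot.liftAlgHom_mkAlgHom_apply]
  simp

@[simp] theorem liftPlus_u (fu : Fin n → Fin n → A) (fF : Fin n → A) (h1) (h2) (i j : Fin n) :
    liftPlus R fu fF h1 h2 (u R i j) = fu i j := by
  simp only [liftPlus, u, mkPlus]
  erw [RingQuot.liftAlgHom_mkAlgHom_apply]
  simp

@[simp] theorem liftPlus_F (fu : Fin n → Fin n → A) (fF : Fin n → A) (h1) (h2) (i : Fin n) :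
    liftPlus R fu fF h1 h2 (F R i) = fF i := by
  simp only [liftPlus, F, mkPlus]
  erw [RingQuot.liftAlgHom_mkAlgHom_apply]
  simp

theorem minus_induction {p : YMinus R → Prop} (hscal : ∀ c : ℂ, p (algebraMap ℂ _ c))
    (ht : ∀ i j, p (t R i j)) (hE : ∀ i, p (E R i)) (hadd : ∀ x y, p x → p y → p (x + y))
    (hmul : ∀ x y, p x → p y → p (x * y)) (x : YMinus R) : p x := by
  obtain ⟨y, rfl⟩ := RingQuot.mkAlgHom_surjective ℂ (RelMinus R) x
  refine FreeAlgebra.induction ℂ (GenMinus n) (motive := fun y => p (mkMinus R y)) ?_ ?_ ?_ ?_ y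
  · intro c; rw [AlgHom.commutes]; exact hscal c
  · rintro (⟨i, j⟩ | i)
    exacts [ht i j, hE i]
  · intro a b ha hb; rw [map_mul]; exact hmul _ _ ha hb
  · intro a b ha hb; rw [map_add]; exact hadd _ _ ha hb

theorem plus_induction {p : YPlus R → Prop} (hscal : ∀ c : ℂ, p (algebraMap ℂ _ c))
    (hu : ∀ i j, p (u R i j)) (hF : ∀ i, p (F R i)) (hadd : ∀ x y, p x → p y → p (x + y))
    (hmul : ∀ x y, p x → p y → p (x * y)) (x : YPlus R) : p x := by
  obtain ⟨y, rfl⟩ := RingQuot.mkAlgHom_surjective ℂ (RelPlus R) x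
  refine FreeAlgebra.induction ℂ (GenPlus n) (motive := fun y => p (mkPlus R y)) ?_ ?_ ?_ ?_ y
  · intro c; rw [AlgHom.commutes]; exact hscal c
  · rintro (⟨i, j⟩ | i)
    exacts [hu i j, hF i]
  · intro a b ha hb; rw [map_mul]; exact hmul _ _ ha hb
  · intro a b ha hb; rw [map_add]; exact hadd _ _ ha hb

theorem minus_hom_ext {f g : YMinus R →ₐ[ℂ] A} (ht : ∀ i j, f (t R i j) = g (t R i j))
    (hE : ∀ i, f (E R i) = g (E R i)) : f = g := by
  ext x
  induction x using minus_induction with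
  | hscal c => simp
  | ht i j => exact ht i j
  | hE i => exact hE i
  | hadd x y hx hy => rw [map_add, map_add, hx, hy]
  | hmul x y hx hy => rw [map_mul, map_mul, hx, hy]

theorem plus_hom_ext {f g : YPlus R →ₐ[ℂ] A} (hu : ∀ i j, f (u R i j) = g (u R i j))
    (hF : ∀ i, f (F R i) = g (F R i)) : f = g := by
  ext x
  induction x using plus_induction with
  | hscal c => simp
  | hu i j => exact hu i j
  | hF i => exact hF i
  | hadd x y hx hy => rw [map_add, map_add, hx, hy]
  | hmul x y hx hy => rw [map_mul, map_mul, hx, hy]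

end lift

end Algebras

/-! ### Bialgebra structures -/

section Bialgebras

variable {n : ℕ} (R : Matrix (Fin n × Fin n) (Fin n × Fin n) ℂ)

section aux
variable {R} {A B : Type*} [Ring A] [Algebra ℂ A] [Ring B] [Algebra ℂ B]

theorem sum4_swap {M ι₁ ι₂ ι₃ ι₄ : Type*} [AddCommMonoid M] {s₁ : Finset ι₁} {s₂ : Finset ι₂}
    {s₃ : Finset ι₃} {s₄ : Finset ι₄} (f : ι₁ → ι₂ → ι₃ → ι₄ → M) :
    ∑ p ∈ s₁, ∑ q ∈ s₂, ∑ k ∈ s₃, ∑ l ∈ s₄, f p q k l =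
      ∑ k ∈ s₃, ∑ l ∈ s₄, ∑ p ∈ s₁, ∑ q ∈ s₂, f p q k l := by
  calc _ = ∑ x ∈ s₁ ×ˢ s₂, ∑ y ∈ s₃ ×ˢ s₄, f x.1 x.2 y.1 y.2 := by
        simp only [Finset.sum_product]
    _ = ∑ y ∈ s₃ ×ˢ s₄, ∑ x ∈ s₁ ×ˢ s₂, f x.1 x.2 y.1 y.2 := Finset.sum_comm
    _ = _ := by simp only [Finset.sum_product]

theorem rtt_tmul {x : Fin n → Fin n → A} {y : Fin n → Fin n → B}
    (hx : ∀ a b c d, ∑ p, ∑ q, R (a, b) (p, q) • (x p c * x q d) =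
      ∑ p, ∑ q, R (p, q) (c, d) • (x b q * x a p))
    (hy : ∀ a b c d, ∑ p, ∑ q, R (a, b) (p, q) • (y p c * y q d) =
      ∑ p, ∑ q, R (p, q) (c, d) • (y b q * y a p)) (a b c d : Fin n) :
    ∑ p, ∑ q, R (a, b) (p, q) •
        ((∑ k, x p k ⊗ₜ[ℂ] y k c) * (∑ l, x q l ⊗ₜ[ℂ] y l d)) =
      ∑ p, ∑ q, R (p, q) (c, d) •
        ((∑ l, x b l ⊗ₜ[ℂ] y l q) * (∑ k, x a k ⊗ₜ[ℂ] y k p)) := by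
  calc _ = ∑ k, ∑ l, (∑ p, ∑ q, R (a, b) (p, q) • (x p k * x q l)) ⊗ₜ[ℂ] (y k c * y l d) := by
        simp only [Finset.sum_mul_sum, Algebra.TensorProduct.tmul_mul_tmul, Finset.smul_sum,
          TensorProduct.sum_tmul, TensorProduct.smul_tmul']
        exact sum4_swap _
    _ = ∑ p, ∑ q, (x b q * x a p) ⊗ₜ[ℂ] ∑ k, ∑ l, R (p, q) (k, l) • (y k c * y l d) := by
        simp only [hx]
        simp only [TensorProduct.sum_tmul, TensorProduct.tmul_sum, TensorProduct.tmul_smul,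
          TensorProduct.smul_tmul']
        exact sum4_swap _
    _ = _ := by
        simp only [hy]
        simp only [Finset.sum_mul_sum, Algebra.TensorProduct.tmul_mul_tmul, Finset.smul_sum,
          TensorProduct.tmul_sum, TensorProduct.tmul_smul]
        rw [sum4_swap]
        exact Finset.sum_congr rfl fun _ _ => Finset.sum_congr rfl fun _ _ => Finset.sum_comm

end aux

/-- `Δ(T) = T ⊗̂ T`, `Δ(E) = E ⊗̂ T + 1 ⊗ E`. -/
def comulMinus : YMinus R →ₐ[ℂ] YMinus R ⊗[ℂ] YMinus R :=
  liftMinus R (fun i j => ∑ k, t R i k ⊗ₜ[ℂ] t R k j)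
    (fun i => ∑ j, E R j ⊗ₜ[ℂ] t R j i + 1 ⊗ₜ[ℂ] E R i)
    (rtt_tmul t_rel t_rel)
    (by
      intro i k j
      simp only [add_mul, mul_add, smul_add, Finset.sum_add_distrib]
      congr 1
      · calc _ = ∑ a, ∑ m, (E R a * t R k m) ⊗ₜ[ℂ] (t R a i * t R m j) := by
              simp only [Finset.sum_mul_sum, Algebra.TensorProduct.tmul_mul_tmul]
          _ = ∑ p, ∑ l, (t R k l * E R p) ⊗ₜ[ℂ] ∑ a, ∑ m, R (p, l) (a, m) •
                (t R a i * t R m j) := by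
              simp only [E_rel]
              simp only [TensorProduct.sum_tmul, TensorProduct.tmul_sum, TensorProduct.tmul_smul,
                TensorProduct.smul_tmul']
              exact sum4_swap _
          _ = _ := by
              simp only [t_rel]
              simp only [Finset.sum_mul_sum, Algebra.TensorProduct.tmul_mul_tmul, Finset.smul_sum,
                TensorProduct.tmul_sum, TensorProduct.tmul_smul]
              rw [sum4_swap]
              exact Finset.sum_congr rfl fun _ _ => Finset.sum_congr rfl fun _ _ => Finset.sum_comm
      · simp only [Finset.mul_sum, Finset.sum_mul, Algebra.TensorProduct.tmul_mul_tmul, one_mul,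
          mul_one, E_rel, TensorProduct.tmul_sum, TensorProduct.tmul_smul, Finset.smul_sum]
        rw [Finset.sum_comm]
        exact Finset.sum_congr rfl fun _ _ => Finset.sum_comm)

/-- `ε(T) = 1`, `ε(E) = 0`. -/
def counitMinus : YMinus R →ₐ[ℂ] ℂ :=
  liftMinus R (fun i j => if i = j then 1 else 0) (fun _ => 0)
    (by intro a b c d; simp [Finset.sum_ite_eq])
    (by intro i k j; simp)

/-- `Δ(U) = U ⊗̂ U`, `Δ(F) = F ⊗ 1 + U ⊗̂ F`. -/
def comulPlus : YPlus R →ₐ[ℂ] YPlus R ⊗[ℂ] YPlus R :=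
  liftPlus R (fun i j => ∑ k, u R i k ⊗ₜ[ℂ] u R k j)
    (fun i => F R i ⊗ₜ[ℂ] 1 + ∑ j, u R i j ⊗ₜ[ℂ] F R j)
    (rtt_tmul u_rel u_rel)
    (by
      intro a b c
      simp only [add_mul, mul_add, smul_add, Finset.sum_add_distrib]
      congr 1
      · simp only [Finset.mul_sum, Finset.sum_mul, Algebra.TensorProduct.tmul_mul_tmul, one_mul,
          mul_one, F_rel, TensorProduct.sum_tmul, TensorProduct.smul_tmul', Finset.smul_sum]
        rw [Finset.sum_comm]
        exact Finset.sum_congr rfl fun _ _ => Finset.sum_comm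
      · calc _ = ∑ p, ∑ q, (u R b q * u R a p) ⊗ₜ[ℂ] (F R q * u R p c) := by
              simp only [Finset.sum_mul_sum, Algebra.TensorProduct.tmul_mul_tmul]
              exact Finset.sum_comm
          _ = ∑ k, ∑ l, (∑ p, ∑ q, R (p, q) (k, l) • (u R b q * u R a p)) ⊗ₜ[ℂ]
                (u R k c * F R l) := by
              simp only [F_rel]
              simp only [TensorProduct.sum_tmul, TensorProduct.tmul_sum, TensorProduct.tmul_smul,
                TensorProduct.smul_tmul']
              exact sum4_swap _
          _ = _ := by
              simp only [← u_rel]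
              simp only [Finset.sum_mul_sum, Algebra.TensorProduct.tmul_mul_tmul, Finset.smul_sum,
                TensorProduct.sum_tmul, TensorProduct.smul_tmul']
              exact sum4_swap _)

/-- `ε(U) = 1`, `ε(F) = 0`. -/
def counitPlus : YPlus R →ₐ[ℂ] ℂ :=
  liftPlus R (fun i j => if i = j then 1 else 0) (fun _ => 0)
    (by intro a b c d; simp [Finset.sum_ite_eq])
    (by intro i k j; simp)

instance : Bialgebra ℂ (YMinus R) :=
  Bialgebra.ofAlgHom (comulMinus R) (counitMinus R)
    (by
      apply minus_hom_ext
      · intro i j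
        simp [comulMinus, TensorProduct.sum_tmul, TensorProduct.tmul_sum]
        exact Finset.sum_comm
      · intro i
        simp [comulMinus, TensorProduct.sum_tmul, TensorProduct.tmul_sum, TensorProduct.add_tmul,
          TensorProduct.tmul_add, Finset.sum_add_distrib, add_assoc, Algebra.TensorProduct.one_def]
        exact Finset.sum_comm)
    (by
      apply minus_hom_ext
      · intro i j
        simp [comulMinus, counitMinus, TensorProduct.ite_tmul]
      · intro i
        simp [comulMinus, counitMinus])
    (by
      apply minus_hom_ext
      · intro i j
        simp [comulMinus, counitMinus, TensorProduct.tmul_ite]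
      · intro i
        simp [comulMinus, counitMinus, TensorProduct.tmul_ite])

instance : Bialgebra ℂ (YPlus R) :=
  Bialgebra.ofAlgHom (comulPlus R) (counitPlus R)
    (by
      apply plus_hom_ext
      · intro i j
        simp [comulPlus, TensorProduct.sum_tmul, TensorProduct.tmul_sum]
        exact Finset.sum_comm
      · intro i
        simp [comulPlus, TensorProduct.sum_tmul, TensorProduct.tmul_sum, TensorProduct.add_tmul,
          TensorProduct.tmul_add, Finset.sum_add_distrib, add_assoc, Algebra.TensorProduct.one_def]
        exact Finset.sum_comm)
    (by
      apply plus_hom_ext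
      · intro i j
        simp [comulPlus, counitPlus, TensorProduct.ite_tmul]
      · intro i
        simp [comulPlus, counitPlus, TensorProduct.ite_tmul])
    (by
      apply plus_hom_ext
      · intro i j
        simp [comulPlus, counitPlus, TensorProduct.tmul_ite]
      · intro i
        simp [comulPlus, counitPlus])

section aux2
variable {R}

@[simp] theorem comul_t (i j : Fin n) :
    Coalgebra.comul (R := ℂ) (t R i j) = ∑ k, t R i k ⊗ₜ[ℂ] t R k j := liftMinus_t _ _ _ _ i j
@[simp] theorem comul_E (i : Fin n) :
    Coalgebra.comul (R := ℂ) (E R i) = ∑ j, E R j ⊗ₜ[ℂ] t R j i + 1 ⊗ₜ[ℂ] E R i :=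
  liftMinus_E _ _ _ _ i
@[simp] theorem counit_t (i j : Fin n) :
    Coalgebra.counit (R := ℂ) (t R i j) = if i = j then 1 else 0 := liftMinus_t _ _ _ _ i j
@[simp] theorem counit_E (i : Fin n) : Coalgebra.counit (R := ℂ) (E R i) = 0 :=
  liftMinus_E _ _ _ _ i
@[simp] theorem comul_u (i j : Fin n) :
    Coalgebra.comul (R := ℂ) (u R i j) = ∑ k, u R i k ⊗ₜ[ℂ] u R k j := liftPlus_u _ _ _ _ i j
@[simp] theorem comul_F (i : Fin n) :
    Coalgebra.comul (R := ℂ) (F R i) = F R i ⊗ₜ[ℂ] 1 + ∑ j, u R i j ⊗ₜ[ℂ] F R j :=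
  liftPlus_F _ _ _ _ i
@[simp] theorem counit_u (i j : Fin n) :
    Coalgebra.counit (R := ℂ) (u R i j) = if i = j then 1 else 0 := liftPlus_u _ _ _ _ i j
@[simp] theorem counit_F (i : Fin n) : Coalgebra.counit (R := ℂ) (F R i) = 0 :=
  liftPlus_F _ _ _ _ i

end aux2

end Bialgebras

/-! ### The skew pairing of `Y₊` and `Y₋` -/

section Pairing

variable {n : ℕ} {R : Matrix (Fin n × Fin n) (Fin n × Fin n) ℂ}

theorem onLegs_mul_apply {N : ℕ} (A : Matrix (Fin n × Fin n) (Fin n × Fin n) ℂ) {i j : Fin N}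
    (hij : i ≠ j) (M : MultiMat n N) (a c : Fin N → Fin n) :
    (onLegs A i j * M) a c = ∑ p, ∑ q, A (a i, a j) (p, q) *
      M (Function.update (Function.update a i p) j q) c := by
  rw [Matrix.mul_apply, ← Fintype.sum_prod_type' (f := fun p q => A (a i, a j) (p, q) *
      M (Function.update (Function.update a i p) j q) c)]
  symm
  refine Finset.sum_of_injOn
    (fun x : Fin n × Fin n => Function.update (Function.update a i x.1) j x.2) ?_ ?_ ?_ ?_
  · rintro ⟨p, q⟩ - ⟨p', q'⟩ - h
    have h1 := congrFun h i
    have h2 := congrFun h j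
    simp [hij] at h1 h2
    simp [h1, h2]
  · simp
  · intro b _ hb
    rw [onLegs, if_neg, zero_mul]
    intro hk
    apply hb
    refine ⟨(b i, b j), by simp, ?_⟩
    funext k
    by_cases hj : k = j
    · subst hj; simp
    by_cases hi : k = i
    · subst hi; simp [hj]
    · simp [hi, hj, hk k hi hj]
  · rintro ⟨p, q⟩ -
    simp only [onLegs]
    rw [if_pos]
    · simp [hij]
    · intro k hi hj
      simp [hi, hj]

/-- The Yang-Baxter equation in components. -/
theorem YangBaxter.entries (h : YangBaxter R) (i a b j c d : Fin n) :
    ∑ m, ∑ p, ∑ q, R (i, a) (m, p) * R (m, b) (j, q) * R (p, q) (c, d) =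
      ∑ p, ∑ q, ∑ m, R (a, b) (p, q) * R (i, q) (m, d) * R (m, p) (j, c) := by
  have h0 : (onLegs R 0 1 * (onLegs R 0 2 * (onLegs R 1 2 * 1)) : MultiMat n 3)
      ![i, a, b] ![j, c, d] =
      (onLegs R 1 2 * (onLegs R 0 2 * (onLegs R 0 1 * 1)) : MultiMat n 3)
      ![i, a, b] ![j, c, d] := by
    rw [mul_one, mul_one, ← mul_assoc, ← mul_assoc, h]
  simp only [onLegs_mul_apply R (show (0 : Fin 3) ≠ 2 by decide),
    onLegs_mul_apply R (show (1 : Fin 3) ≠ 2 by decide),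
    onLegs_mul_apply R (show (0 : Fin 3) ≠ 1 by decide)] at h0
  simp [Matrix.one_apply, funext_iff, Fin.forall_fin_succ, ite_and, Finset.sum_ite_irrel] at h0
  simpa only [Finset.mul_sum, mul_assoc] using h0

/-- The action of `t^k_l` on `V ⊕ ℂ`: the matrix `⟨Û, t^k_l⟩` for `Û = [[U, F], [0, 1]]`. -/
def evalT (R : Matrix (Fin n × Fin n) (Fin n × Fin n) ℂ) (k l : Fin n) :
    Matrix (Option (Fin n)) (Option (Fin n)) ℂ
  | some i, some j => R (i, k) (j, l)
  | none, none => if k = l then 1 else 0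
  | _, _ => 0

/-- The action of `E_i` on `V ⊕ ℂ`: the matrix `⟨Û, E_i⟩` for `Û = [[U, F], [0, 1]]`. -/
def evalE (i : Fin n) : Matrix (Option (Fin n)) (Option (Fin n)) ℂ
  | some a, none => if a = i then 1 else 0
  | _, _ => 0

/-- The antirepresentation `a ↦ ⟨Û, a⟩ = [[⟨U, a⟩, ⟨F, a⟩], [0, ε(a)]]` of `Y₋` on `V ⊕ ℂ`. -/
def repMinus (hR : YangBaxter R) :
    YMinus R →ₐ[ℂ] (Matrix (Option (Fin n)) (Option (Fin n)) ℂ)ᵐᵒᵖ :=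
  liftMinus R (fun k l => .op (evalT R k l)) (fun i => .op (evalE i))
    (by
      intro a b c d
      apply MulOpposite.unop_injective
      simp only [← MulOpposite.op_mul, ← MulOpposite.op_smul, Finset.unop_sum,
        MulOpposite.unop_op]
      ext (_ | i) (_ | j)
      · simp [Matrix.sum_apply, Matrix.mul_apply, Fintype.sum_option, evalT]
      · simp [Matrix.sum_apply, Matrix.mul_apply, Fintype.sum_option, evalT]
      · simp [Matrix.sum_apply, Matrix.mul_apply, Fintype.sum_option, evalT]
      · simp [Matrix.sum_apply, Matrix.mul_apply, Fintype.sum_option, evalT]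
        have h := hR.entries i a b j c d
        simp only [Finset.mul_sum, ← mul_assoc]
        rw [← h, Finset.sum_comm]
        refine Finset.sum_congr rfl fun p _ => ?_
        rw [Finset.sum_comm]
        refine Finset.sum_congr rfl fun q _ => Finset.sum_congr rfl fun m _ => ?_
        ring)
    (by
      intro i k j
      apply MulOpposite.unop_injective
      simp only [← MulOpposite.op_mul, ← MulOpposite.op_smul, Finset.unop_sum,
        MulOpposite.unop_op]
      ext (_ | i) (_ | j) <;>
      simp [Matrix.sum_apply, Matrix.mul_apply, Fintype.sum_option, evalT, evalE])

/-- The matrix entries of `repMinus`, as functionals on `Y₋`. -/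
def ent (hR : YangBaxter R) (I J : Option (Fin n)) : YMinus R →ₗ[ℂ] ℂ where
  toFun a := (repMinus hR a).unop I J
  map_add' := by simp
  map_smul' := by simp

section ent
variable (hR : YangBaxter R)

theorem ent_mul (I J : Option (Fin n)) (x y : YMinus R) :
    ent hR I J (x * y) = ∑ K, ent hR I K y * ent hR K J x := by
  simp [ent, Matrix.mul_apply]

theorem ent_algebraMap (I J : Option (Fin n)) (c : ℂ) :
    ent hR I J (algebraMap ℂ _ c) = if I = J then c else 0 := by
  simp [ent, Matrix.algebraMap_matrix_apply]

@[simp] theorem ent_one (I J : Option (Fin n)) : ent hR I J 1 = if I = J then 1 else 0 := by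
  simpa using ent_algebraMap hR I J 1

@[simp] theorem ent_t (I J : Option (Fin n)) (k l : Fin n) : ent hR I J (t R k l) = evalT R k l I J := by
  simp [ent, repMinus]

@[simp] theorem ent_E (I J : Option (Fin n)) (i : Fin n) : ent hR I J (E R i) = evalE i I J := by
  simp [ent, repMinus]

@[simp] theorem ent_none_some (j : Fin n) (x : YMinus R) : ent hR none (some j) x = 0 := by
  induction x using minus_induction generalizing j with
  | hscal c => simp [ent_algebraMap]
  | ht i j => simp [evalT]
  | hE i => simp [evalE]
  | hadd x y hx hy => simp [hx, hy]
  | hmul x y hx hy => simp [ent_mul, Fintype.sum_option, hx, hy]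

@[simp] theorem ent_none_none (x : YMinus R) : ent hR none none x = Coalgebra.counit (R := ℂ) x := by
  induction x using minus_induction with
  | hscal c => simp [ent_algebraMap]
  | ht i j => simp [evalT]
  | hE i => simp [evalE]
  | hadd x y hx hy => simp [hx, hy]
  | hmul x y hx hy => simp [ent_mul, Fintype.sum_option, hx, hy, mul_comm]

/-- The convolution product `(f * g)(a) = f(a₍₁₎) g(a₍₂₎)` of entries. -/
def conv (f g : YMinus R →ₗ[ℂ] ℂ) (x : YMinus R) : ℂ :=
  LinearMap.mul' ℂ ℂ (TensorProduct.map f g (Coalgebra.comul x))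

theorem conv_repr (f g : YMinus R →ₗ[ℂ] ℂ) {ι : Type*} {x : YMinus R} (r : Coalgebra.Repr ℂ x ι) :
    conv f g x = ∑ i ∈ r.index, f (r.left i) * g (r.right i) := by
  simp [conv, ← r.eq]

theorem conv_mul {f g : YMinus R →ₗ[ℂ] ℂ} {ι κ : Type*} [Fintype ι] [Fintype κ]
    {f₁ f₂ : ι → YMinus R →ₗ[ℂ] ℂ} {g₁ g₂ : κ → YMinus R →ₗ[ℂ] ℂ}
    (hf : ∀ x y, f (x * y) = ∑ i, f₁ i y * f₂ i x)
    (hg : ∀ x y, g (x * y) = ∑ i, g₁ i y * g₂ i x) (x y : YMinus R) :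
    conv f g (x * y) = ∑ i, ∑ j, conv (f₁ i) (g₁ j) y * conv (f₂ i) (g₂ j) x := by
  have h : conv f g (x * y) = ∑ a ∈ (Coalgebra.Repr.arbitrary ℂ x).index,
      ∑ b ∈ (Coalgebra.Repr.arbitrary ℂ y).index,
      f ((Coalgebra.Repr.arbitrary ℂ x).left a * (Coalgebra.Repr.arbitrary ℂ y).left b) *
      g ((Coalgebra.Repr.arbitrary ℂ x).right a * (Coalgebra.Repr.arbitrary ℂ y).right b) := by
    rw [conv, Bialgebra.comul_mul]
    conv_lhs => rw [← (Coalgebra.Repr.arbitrary ℂ x).eq, ← (Coalgebra.Repr.arbitrary ℂ y).eq]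
    simp [Finset.sum_mul_sum]
  rw [h]
  simp only [conv_repr _ _ (Coalgebra.Repr.arbitrary ℂ x),
    conv_repr _ _ (Coalgebra.Repr.arbitrary ℂ y), hf, hg, Finset.sum_mul_sum]
  rw [sum4_swap]
  refine Finset.sum_congr rfl fun i _ => Finset.sum_congr rfl fun j _ => ?_
  rw [Finset.sum_comm]
  refine Finset.sum_congr rfl fun a _ => Finset.sum_congr rfl fun b _ => ?_
  ring

/-- `⟨U₁Û₂, x⟩`. -/
def mat1 (x : YMinus R) : Matrix (Fin n × Option (Fin n)) (Fin n × Option (Fin n)) ℂ :=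
  fun a b => conv (ent hR (some a.1) (some b.1)) (ent hR a.2 b.2) x

/-- `⟨Û₂U₁, x⟩`. -/
def mat2 (x : YMinus R) : Matrix (Fin n × Option (Fin n)) (Fin n × Option (Fin n)) ℂ :=
  fun a b => conv (ent hR a.2 b.2) (ent hR (some a.1) (some b.1)) x

/-- `R` on `V ⊗ V`, extended by the identity on `V ⊗ ℂ`, as a matrix on `V ⊗ (V ⊕ ℂ)`. -/
def extR (R : Matrix (Fin n × Fin n) (Fin n × Fin n) ℂ) :
    Matrix (Fin n × Option (Fin n)) (Fin n × Option (Fin n)) ℂ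
  | (a, some b), (c, some d) => R (a, b) (c, d)
  | (a, none), (c, none) => if a = c then 1 else 0
  | _, _ => 0

theorem ent_some_mul (i j : Fin n) (x y : YMinus R) :
    ent hR (some i) (some j) (x * y) =
      ∑ k : Fin n, ent hR (some i) (some k) y * ent hR (some k) (some j) x := by
  simp [ent_mul, Fintype.sum_option]

theorem mat1_mul (x y : YMinus R) : mat1 hR (x * y) = mat1 hR y * mat1 hR x := by
  ext ⟨a, B⟩ ⟨c, D⟩
  rw [Matrix.mul_apply, Fintype.sum_prod_type]
  exact conv_mul (ent_some_mul hR a c) (ent_mul hR B D) x y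

theorem mat2_mul (x y : YMinus R) : mat2 hR (x * y) = mat2 hR y * mat2 hR x := by
  ext ⟨a, B⟩ ⟨c, D⟩
  rw [Matrix.mul_apply, Fintype.sum_prod_type, Finset.sum_comm]
  exact conv_mul (ent_mul hR B D) (ent_some_mul hR a c) x y

theorem mat_intertwine (x : YMinus R) : extR R * mat1 hR x = mat2 hR x * extR R := by
  induction x using minus_induction with
  | hscal c =>
    have h1 : mat1 hR (algebraMap ℂ _ c) = algebraMap ℂ _ c := by
      ext ⟨a, B⟩ ⟨d, D⟩
      simp [mat1, conv, Matrix.algebraMap_matrix_apply, ent_algebraMap,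
        Algebra.TensorProduct.algebraMap_apply, ite_and]
      split_ifs <;> rfl
    have h2 : mat2 hR (algebraMap ℂ _ c) = algebraMap ℂ _ c := by
      ext ⟨a, B⟩ ⟨d, D⟩
      simp [mat2, conv, Matrix.algebraMap_matrix_apply, ent_algebraMap,
        Algebra.TensorProduct.algebraMap_apply, ite_and]
    rw [h1, h2, Algebra.commutes]
  | ht k l => 
    ext ⟨a, _ | b⟩ ⟨c, _ | d⟩
    · simp [Matrix.mul_apply, Fintype.sum_prod_type, Fintype.sum_option, mat1, mat2, conv, extR, evalT]
    · simp [Matrix.mul_apply, Fintype.sum_prod_type, Fintype.sum_option, mat1, mat2, conv, extR, evalT]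
    · simp [Matrix.mul_apply, Fintype.sum_prod_type, Fintype.sum_option, mat1, mat2, conv, extR, evalT]
    · simp [Matrix.mul_apply, Fintype.sum_prod_type, Fintype.sum_option, mat1, mat2, conv, extR, evalT]
      have h := hR.entries a b k c d l
      simp only [Finset.mul_sum, Finset.sum_mul, ← mul_assoc]
      rw [h]
      conv_rhs => rw [Finset.sum_comm]
      exact Finset.sum_congr rfl fun p _ => Finset.sum_comm
  | hE i => 
    ext ⟨a, _ | b⟩ ⟨c, _ | d⟩
    · simp [Matrix.mul_apply, Fintype.sum_prod_type, Fintype.sum_option, mat1, mat2, conv, extR,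
        evalT, evalE]
    · simp [Matrix.mul_apply, Fintype.sum_prod_type, Fintype.sum_option, mat1, mat2, conv, extR,
        evalT, evalE]
    · simp [Matrix.mul_apply, Fintype.sum_prod_type, Fintype.sum_option, mat1, mat2, conv, extR,
        evalT, evalE]
    · simp [Matrix.mul_apply, Fintype.sum_prod_type, Fintype.sum_option, mat1, mat2, conv, extR,
        evalT, evalE]
  | hadd x y hx hy =>
    have h1 : mat1 hR (x + y) = mat1 hR x + mat1 hR y := by ext; simp [mat1, conv]
    have h2 : mat2 hR (x + y) = mat2 hR x + mat2 hR y := by ext; simp [mat2, conv]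
    rw [h1, h2, mul_add, add_mul, hx, hy]
  | hmul x y hx hy =>
    rw [mat1_mul, mat2_mul, ← mul_assoc, hy, mul_assoc, hx, mul_assoc]

/-- An entry, as an element of the convolution algebra of functionals on `Y₋`. -/
def entConv (I J : Option (Fin n)) : WithConv (YMinus R →ₗ[ℂ] ℂ) := .toConv (ent hR I J)

/-- The algebra map `x ↦ ⟨x, ·⟩` from `Y₊` to the functionals on `Y₋` with the convolution product:
it sends `u^i_j` to `⟨u^i_j, ·⟩` and `F^i` to `⟨F^i, ·⟩`. -/
def pairingHom : YPlus R →ₐ[ℂ] WithConv (YMinus R →ₗ[ℂ] ℂ) :=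
  liftPlus R (fun i j => entConv hR (some i) (some j)) (fun i => entConv hR (some i) none)
    (by
      intro a b c d
      apply WithConv.ext
      ext x
      have h := congrFun (congrFun (mat_intertwine hR x) (a, some b)) (c, some d)
      simp [Matrix.mul_apply, Fintype.sum_prod_type, Fintype.sum_option, mat1, mat2, conv,
        extR] at h
      simpa [entConv, mul_comm] using h)
    (by
      intro a b c
      apply WithConv.ext
      ext x
      have h := congrFun (congrFun (mat_intertwine hR x) (a, some b)) (c, none)
      simp [Matrix.mul_apply, Fintype.sum_prod_type, Fintype.sum_option, mat1, mat2, conv,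
        extR] at h
      simpa [entConv] using h.symm)

/-- The skew pairing `⟨x, a⟩` of `x ∈ Y₊` and `a ∈ Y₋`. -/
def pairing : YPlus R →ₗ[ℂ] YMinus R →ₗ[ℂ] ℂ where
  toFun x := (pairingHom hR x).ofConv
  map_add' := by simp
  map_smul' := by simp

/-- `⟨x ⊗ y, ξ⟩` for `ξ ∈ Y₋ ⊗ Y₋`. -/
def pairing₂Left (x y : YPlus R) : YMinus R ⊗[ℂ] YMinus R →ₗ[ℂ] ℂ :=
  LinearMap.mul' ℂ ℂ ∘ₗ TensorProduct.map (pairing hR x) (pairing hR y)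

/-- `⟨ξ, a ⊗ b⟩` for `ξ ∈ Y₊ ⊗ Y₊`. -/
def pairing₂Right (a b : YMinus R) : YPlus R ⊗[ℂ] YPlus R →ₗ[ℂ] ℂ :=
  LinearMap.mul' ℂ ℂ ∘ₗ TensorProduct.map ((pairing hR).flip a) ((pairing hR).flip b)

/-- `⟨U, T⟩ = R`. -/
theorem pairing_u_t (i j k l : Fin n) : pairing hR (u R i j) (t R k l) = R (i, k) (j, l) := by
  simp [pairing, pairingHom, entConv, evalT]

/-- `⟨F, E⟩ = 1`. -/
theorem pairing_F_E (i j : Fin n) : pairing hR (F R i) (E R j) = if i = j then 1 else 0 := by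
  simp [pairing, pairingHom, entConv, evalE]

/-- `⟨U, E⟩ = 0`. -/
theorem pairing_u_E (i j k : Fin n) : pairing hR (u R i j) (E R k) = 0 := by
  simp [pairing, pairingHom, entConv, evalE]

/-- `⟨F, T⟩ = 0`. -/
theorem pairing_F_t (i k l : Fin n) : pairing hR (F R i) (t R k l) = 0 := by
  simp [pairing, pairingHom, entConv, evalT]

/-- `⟨1, a⟩ = ε(a)`. -/
theorem pairing_one_left (a : YMinus R) : pairing hR 1 a = Coalgebra.counit (R := ℂ) a := by
  simp [pairing]

/-- `⟨xy, a⟩ = ⟨x ⊗ y, Δ(a)⟩`. -/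
theorem pairing_mul_left (x y : YPlus R) (a : YMinus R) :
    pairing hR (x * y) a = pairing₂Left hR x y (Coalgebra.comul a) := by
  simp [pairing, pairing₂Left]

theorem pairing₂Left_repr (x y : YPlus R) (a : YMinus R) {ι : Type*} (r : Coalgebra.Repr ℂ a ι) :
    pairing₂Left hR x y (Coalgebra.comul a) =
      ∑ i ∈ r.index, pairing hR x (r.left i) * pairing hR y (r.right i) := by
  simp [pairing₂Left, ← r.eq]

theorem pairing₂Right_repr (a b : YMinus R) (x : YPlus R) {ι : Type*} (r : Coalgebra.Repr ℂ x ι) :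
    pairing₂Right hR a b (Coalgebra.comul x) =
      ∑ i ∈ r.index, pairing hR (r.left i) a * pairing hR (r.right i) b := by
  simp [pairing₂Right, ← r.eq]

/-- `⟨x, 1⟩ = ε(x)`. -/
theorem pairing_one_right (x : YPlus R) : pairing hR x 1 = Coalgebra.counit (R := ℂ) x := by
  induction x using plus_induction with
  | hscal c => simp [pairing]
  | hu i j => simp [pairing, pairingHom, entConv]
  | hF i => simp [pairing, pairingHom, entConv]
  | hadd x y hx hy => simp [hx, hy]
  | hmul x y hx hy =>
    rw [pairing_mul_left]
    simp [pairing₂Left, hx, hy, Algebra.TensorProduct.one_def]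

/-- `⟨x, ba⟩ = ⟨Δ(x), a ⊗ b⟩`. -/
theorem pairing_mul_right (x : YPlus R) (a b : YMinus R) :
    pairing hR x (b * a) = pairing₂Right hR a b (Coalgebra.comul x) := by
  induction x using plus_induction generalizing a b with
  | hscal c =>
    simp [pairing, pairing₂Right, Algebra.TensorProduct.algebraMap_apply]
    ring
  | hu i j => simp [pairing, pairing₂Right, pairingHom, entConv, ent_some_mul]
  | hF i => simp [pairing, pairing₂Right, pairingHom, entConv, ent_mul, Fintype.sum_option]
  | hadd x y hx hy => simp [hx, hy]
  | hmul x y hx hy =>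
    let ra := Coalgebra.Repr.arbitrary ℂ a
    let rb := Coalgebra.Repr.arbitrary ℂ b
    let rx := Coalgebra.Repr.arbitrary ℂ x
    let ry := Coalgebra.Repr.arbitrary ℂ y
    have h1 : pairing hR (x * y) (b * a) = ∑ i ∈ ra.index, ∑ j ∈ rb.index,
        pairing hR x (rb.left j * ra.left i) * pairing hR y (rb.right j * ra.right i) := by
      rw [pairing_mul_left, Bialgebra.comul_mul, ← ra.eq, ← rb.eq, Finset.sum_mul_sum,
        Finset.sum_comm]
      simp [pairing₂Left]
    have h2 : pairing₂Right hR a b (Coalgebra.comul (x * y)) =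
        ∑ k ∈ rx.index, ∑ l ∈ ry.index,
        pairing hR (rx.left k * ry.left l) a * pairing hR (rx.right k * ry.right l) b := by
      rw [Bialgebra.comul_mul, ← rx.eq, ← ry.eq, Finset.sum_mul_sum]
      simp [pairing₂Right]
    rw [h1, h2]
    simp only [hx, hy, pairing₂Right_repr hR _ _ x rx, pairing₂Right_repr hR _ _ y ry,
      pairing_mul_left, pairing₂Left_repr hR _ _ a ra, pairing₂Left_repr hR _ _ b rb,
      Finset.sum_mul_sum]
    rw [sum4_swap]
    refine Finset.sum_congr rfl fun _ _ => Finset.sum_congr rfl fun _ _ =>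
      Finset.sum_congr rfl fun _ _ => Finset.sum_congr rfl fun _ _ => ?_
    ring

/-! ### The pure `T` and `U` null ideals and the quotients by them -/

variable (R) in
/-- The subalgebra `Y₋(T)` of `Y₋` generated by the `t^i_j`. -/
def subT : Subalgebra ℂ (YMinus R) :=
  Algebra.adjoin ℂ (Set.range fun p : Fin n × Fin n => t R p.1 p.2)

variable (R) in
/-- The subalgebra `Y₊(U)` of `Y₊` generated by the `u^i_j`. -/
def subU : Subalgebra ℂ (YPlus R) :=
  Algebra.adjoin ℂ (Set.range fun p : Fin n × Fin n => u R p.1 p.2)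

/-- The pure-`T` null ideal `I₋ = {a ∈ Y₋(T) : ⟨Y₊(U), a⟩ = 0}`. -/
def nullT : Set (YMinus R) := {a | a ∈ subT R ∧ ∀ x ∈ subU R, pairing hR x a = 0}

/-- The pure-`U` null ideal `I₊ = {x ∈ Y₊(U) : ⟨x, Y₋(T)⟩ = 0}`. -/
def nullU : Set (YPlus R) := {x | x ∈ subU R ∧ ∀ a ∈ subT R, pairing hR x a = 0}

/-- The two-sided ideal `Y₋ I₋ Y₋` of `Y₋` generated by `I₋`. -/
def extNullT : TwoSidedIdeal (YMinus R) := .span (nullT hR)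

/-- The two-sided ideal `Y₊ I₊ Y₊` of `Y₊` generated by `I₊`. -/
def extNullU : TwoSidedIdeal (YPlus R) := .span (nullU hR)

variable (R) in
/-- The projection `E ↦ 0` of `Y₋` onto `Y₋(T)`. -/
def projT : YMinus R →ₐ[ℂ] YMinus R :=
  liftMinus R (t R) (fun _ => 0) t_rel (by simp)

variable (R) in
/-- The projection `F ↦ 0` of `Y₊` onto `Y₊(U)`. -/
def projU : YPlus R →ₐ[ℂ] YPlus R :=
  liftPlus R (u R) (fun _ => 0) u_rel (by simp)

theorem projT_of_mem {a : YMinus R} (ha : a ∈ subT R) : projT R a = a := by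
  refine (AlgHom.mem_equalizer (projT R) (AlgHom.id ℂ _) a).1 ?_
  refine Algebra.adjoin_le ?_ ha
  rintro _ ⟨p, rfl⟩
  simp [projT]

theorem projU_of_mem {x : YPlus R} (hx : x ∈ subU R) : projU R x = x := by
  refine (AlgHom.mem_equalizer (projU R) (AlgHom.id ℂ _) x).1 ?_
  refine Algebra.adjoin_le ?_ hx
  rintro _ ⟨p, rfl⟩
  simp [projU]

theorem projT_mem (a : YMinus R) : projT R a ∈ subT R := by
  induction a using minus_induction with
  | hscal c => simp only [AlgHom.commutes]; exact Subalgebra.algebraMap_mem _ c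
  | ht i j => exact Algebra.subset_adjoin ⟨(i, j), by simp [projT]⟩
  | hE i => simp [projT]
  | hadd x y hx hy => rw [map_add]; exact add_mem hx hy
  | hmul x y hx hy => rw [map_mul]; exact mul_mem hx hy

theorem projU_mem (a : YPlus R) : projU R a ∈ subU R := by
  induction a using plus_induction with
  | hscal c => simp only [AlgHom.commutes]; exact Subalgebra.algebraMap_mem _ c
  | hu i j => exact Algebra.subset_adjoin ⟨(i, j), by simp [projU]⟩
  | hF i => simp [projU]
  | hadd x y hx hy => rw [map_add]; exact add_mem hx hy
  | hmul x y hx hy => rw [map_mul]; exact mul_mem hx hy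

theorem comul_projT (a : YMinus R) : Coalgebra.comul (R := ℂ) (projT R a) =
    Algebra.TensorProduct.map (projT R) (projT R) (Coalgebra.comul a) := by
  have h : (Bialgebra.comulAlgHom ℂ (YMinus R)).comp (projT R) =
      (Algebra.TensorProduct.map (projT R) (projT R)).comp (Bialgebra.comulAlgHom ℂ (YMinus R)) := by
    apply minus_hom_ext
    · intro i j; simp [projT]
    · intro i; simp [projT]
  exact DFunLike.congr_fun h a

theorem ent_projT_some (i j : Fin n) (a : YMinus R) :
    ent hR (some i) (some j) (projT R a) = ent hR (some i) (some j) a := by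
  induction a using minus_induction generalizing i j with
  | hscal c => simp
  | ht k l => simp [projT]
  | hE k => simp [projT, evalE]
  | hadd x y hx hy => simp [hx, hy]
  | hmul x y hx hy => simp [ent_some_mul, hx, hy]

theorem ent_projT_none (i : Fin n) (a : YMinus R) : ent hR (some i) none (projT R a) = 0 := by
  induction a using minus_induction generalizing i with
  | hscal c => simp [ent_algebraMap]
  | ht k l => simp [projT, evalT]
  | hE k => simp [projT]
  | hadd x y hx hy => simp [hx, hy]
  | hmul x y hx hy => simp [ent_mul, Fintype.sum_option, hx, hy]

theorem pairing_proj (x : YPlus R) (a : YMinus R) :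
    pairing hR x (projT R a) = pairing hR (projU R x) a := by
  induction x using plus_induction generalizing a with
  | hscal c =>
    have h : (Bialgebra.counitAlgHom ℂ (YMinus R)).comp (projT R) =
        Bialgebra.counitAlgHom ℂ (YMinus R) := by
      apply minus_hom_ext
      · intro i j; simp [projT]
      · intro i; simp [projT]
    have h' : Coalgebra.counit (R := ℂ) (projT R a) = Coalgebra.counit (R := ℂ) a :=
      DFunLike.congr_fun h a
    rw [AlgHom.commutes]
    simp [pairing, h']
  | hu i j => simp [pairing, pairingHom, entConv, projU, ent_projT_some]
  | hF i => simp [pairing, pairingHom, entConv, projU, ent_projT_none]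
  | hadd x y hx hy => simp [hx, hy]
  | hmul x y hx hy =>
    rw [map_mul (projU R), pairing_mul_left, pairing_mul_left, comul_projT,
      ← (Coalgebra.Repr.arbitrary ℂ a).eq]
    simp [pairing₂Left, hx, hy]

theorem pairing_extNullT (x : YPlus R) {a : YMinus R} (ha : a ∈ extNullT hR) :
    pairing hR x a = 0 := by
  induction ha using TwoSidedIdeal.span_induction generalizing x with
  | mem a h => rw [← projT_of_mem h.1, pairing_proj]; exact h.2 _ (projU_mem x)
  | zero => simp
  | add a b _ _ iha ihb => simp [iha, ihb]
  | neg a _ iha => simp [iha]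
  | left_absorb b a _ iha =>
    rw [pairing_mul_right, pairing₂Right_repr hR _ _ x (Coalgebra.Repr.arbitrary ℂ x)]
    simp [iha]
  | right_absorb b a _ iha =>
    rw [pairing_mul_right, pairing₂Right_repr hR _ _ x (Coalgebra.Repr.arbitrary ℂ x)]
    simp [iha]

theorem pairing_extNullU {x : YPlus R} (a : YMinus R) (hx : x ∈ extNullU hR) :
    pairing hR x a = 0 := by
  induction hx using TwoSidedIdeal.span_induction generalizing a with
  | mem x h => rw [← projU_of_mem h.1, ← pairing_proj]; exact h.2 _ (projT_mem a)
  | zero => simp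
  | add a b _ _ iha ihb => simp [iha, ihb]
  | neg a _ iha => simp [iha]
  | left_absorb y x _ ihx =>
    rw [pairing_mul_left, pairing₂Left_repr hR _ _ a (Coalgebra.Repr.arbitrary ℂ a)]
    simp [ihx]
  | right_absorb y x _ ihx =>
    rw [pairing_mul_left, pairing₂Left_repr hR _ _ a (Coalgebra.Repr.arbitrary ℂ a)]
    simp [ihx]

/-- The quotient of `Y₋` by the extended pure-`T` null ideal. -/
def QMinus : Type := YMinus R ⧸ (extNullT hR).asIdeal

/-- The quotient of `Y₊` by the extended pure-`U` null ideal. -/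
def QPlus : Type := YPlus R ⧸ (extNullU hR).asIdeal

instance : Ring (QMinus hR) := inferInstanceAs (Ring (YMinus R ⧸ (extNullT hR).asIdeal))
instance : Algebra ℂ (QMinus hR) :=
  inferInstanceAs (Algebra ℂ (YMinus R ⧸ (extNullT hR).asIdeal))
instance : Ring (QPlus hR) := inferInstanceAs (Ring (YPlus R ⧸ (extNullU hR).asIdeal))
instance : Algebra ℂ (QPlus hR) :=
  inferInstanceAs (Algebra ℂ (YPlus R ⧸ (extNullU hR).asIdeal))

/-- The quotient map `Y₋ → QMinus`. -/
def toQMinus : YMinus R →ₐ[ℂ] QMinus hR := Ideal.Quotient.mkₐ ℂ (extNullT hR).asIdeal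

/-- The quotient map `Y₊ → QPlus`. -/
def toQPlus : YPlus R →ₐ[ℂ] QPlus hR := Ideal.Quotient.mkₐ ℂ (extNullU hR).asIdeal

theorem toQMinus_surjective : Function.Surjective (toQMinus hR) :=
  Ideal.Quotient.mkₐ_surjective ℂ _

theorem toQPlus_surjective : Function.Surjective (toQPlus hR) :=
  Ideal.Quotient.mkₐ_surjective ℂ _

theorem toQMinus_eq_zero {a : YMinus R} : toQMinus hR a = 0 ↔ a ∈ extNullT hR :=
  Ideal.Quotient.eq_zero_iff_mem.trans TwoSidedIdeal.mem_asIdeal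

theorem toQPlus_eq_zero {x : YPlus R} : toQPlus hR x = 0 ↔ x ∈ extNullU hR :=
  Ideal.Quotient.eq_zero_iff_mem.trans TwoSidedIdeal.mem_asIdeal

/-- The linear map induced on a quotient. -/
def descend {A Q M : Type*} [AddCommGroup A] [Module ℂ A] [AddCommGroup Q] [Module ℂ Q]
    [AddCommGroup M] [Module ℂ M] (π : A →ₗ[ℂ] Q) (hπ : Function.Surjective π) (f : A →ₗ[ℂ] M)
    (hf : ∀ a, π a = 0 → f a = 0) : Q →ₗ[ℂ] M :=
  (LinearMap.ker π).liftQ f (fun a ha => hf a ha) ∘ₗ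
    (π.quotKerEquivOfSurjective hπ).symm.toLinearMap

theorem descend_apply {A Q M : Type*} [AddCommGroup A] [Module ℂ A] [AddCommGroup Q] [Module ℂ Q]
    [AddCommGroup M] [Module ℂ M] (π : A →ₗ[ℂ] Q) (hπ : Function.Surjective π) (f : A →ₗ[ℂ] M)
    (hf : ∀ a, π a = 0 → f a = 0) (a : A) : descend π hπ f hf (π a) = f a := by
  have h : (π.quotKerEquivOfSurjective hπ).symm (π a) = Submodule.Quotient.mk a := by
    rw [LinearEquiv.symm_apply_eq]; rfl
  simp only [descend, LinearMap.comp_apply, LinearEquiv.coe_coe, h]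
  exact Submodule.liftQ_apply _ _ _

/-- The pairing of `YPlus` and `QMinus` induced by `pairing`. -/
def pairingHalf : YPlus R →ₗ[ℂ] QMinus hR →ₗ[ℂ] ℂ :=
  (descend (toQMinus hR).toLinearMap (toQMinus_surjective hR) (pairing hR).flip (by
    intro a ha
    ext x
    exact pairing_extNullT hR x ((toQMinus_eq_zero hR).1 ha))).flip

theorem pairingHalf_apply (x : YPlus R) (a : YMinus R) :
    pairingHalf hR x (toQMinus hR a) = pairing hR x a :=
  congrArg (fun f : YPlus R →ₗ[ℂ] ℂ => f x) (descend_apply (toQMinus hR).toLinearMap _ _ _ a)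

/-- The pairing `⟨x, a⟩` of `QPlus` and `QMinus` induced by `pairing`. -/
def pairingQ : QPlus hR →ₗ[ℂ] QMinus hR →ₗ[ℂ] ℂ :=
  descend (toQPlus hR).toLinearMap (toQPlus_surjective hR) (pairingHalf hR) (by
    intro x hx
    ext a
    obtain ⟨a, rfl⟩ := toQMinus_surjective hR a
    rw [pairingHalf_apply]
    exact pairing_extNullU hR a ((toQPlus_eq_zero hR).1 hx))

/-- The pairing on the quotients is induced by the pairing of `Y₊` and `Y₋`. -/
theorem pairingQ_apply (x : YPlus R) (a : YMinus R) :
    pairingQ hR (toQPlus hR x) (toQMinus hR a) = pairing hR x a := by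
  rw [← pairingHalf_apply]
  exact congrArg (fun f : QMinus hR →ₗ[ℂ] ℂ => f (toQMinus hR a))
    (descend_apply (toQPlus hR).toLinearMap _ _ _ x)

/-- The null ideal of `QMinus`: the elements that pair to zero with all of `QPlus`. -/
def nullMinus : Submodule ℂ (QMinus hR) := LinearMap.ker (pairingQ hR).flip

/-- The null ideal of `QPlus`: the elements that pair to zero with all of `QMinus`. -/
def nullPlus : Submodule ℂ (QPlus hR) := LinearMap.ker (pairingQ hR)

/-! ### Relators -/

/-- The space `V = (ℂⁿ)^{⊗N}` of tensors `ω^{[α]}`, `[α] = (α₁, …, α_N)`. -/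
abbrev Tens (n N : ℕ) : Type := (Fin N → Fin n) → ℂ

/-- `Y₋(T)`: the subalgebra of the quotient algebra generated by the `t^i_j`. -/
def QT : Subalgebra ℂ (QMinus hR) :=
  Algebra.adjoin ℂ (Set.range fun p : Fin n × Fin n => toQMinus hR (t R p.1 p.2))

/-- `Y₊(U)`: the subalgebra of the quotient algebra generated by the `u^i_j`. -/
def QU : Subalgebra ℂ (QPlus hR) :=
  Algebra.adjoin ℂ (Set.range fun p : Fin n × Fin n => toQPlus hR (u R p.1 p.2))

/-- The monomial `E_{α₁} ⋯ E_{α_N}` in the quotient algebra. -/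
def monoE {N : ℕ} (α : Fin N → Fin n) : QMinus hR :=
  (List.ofFn fun i => toQMinus hR (E R (α i))).prod

/-- The monomial `F^{α₁} ⋯ F^{α_N}` in the quotient algebra. -/
def monoF {N : ℕ} (α : Fin N → Fin n) : QPlus hR :=
  (List.ofFn fun i => toQPlus hR (F R (α i))).prod

/-- `E_{α₁} ⋯ E_{α_N} ω^{α₁…α_N}` with numerical coefficients. -/
def relE {N : ℕ} (ω : Tens n N) : QMinus hR := ∑ α, ω α • monoE hR α

/-- `η_{α₁…α_N} F^{α₁} ⋯ F^{α_N}` with numerical coefficients. -/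
def relF {N : ℕ} (η : Tens n N) : QPlus hR := ∑ α, η α • monoF hR α

/-- The general `E`-relator `ω^{[α]}(T) E_{[α]}` for `ω(T) ∈ V ⊗ Y₋(T)`: the linear map with
`v ⊗ a ↦ ∑_α v^α a E_{[α]}`. -/
def relET {N : ℕ} : Tens n N ⊗[ℂ] QT hR →ₗ[ℂ] QMinus hR :=
  TensorProduct.lift (∑ α : Fin N → Fin n,
    (LinearMap.proj (R := ℂ) (φ := fun _ : Fin N → Fin n => ℂ) α).smulRight
      (LinearMap.mulRight ℂ (monoE hR α) ∘ₗ (QT hR).val.toLinearMap))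

theorem relET_tmul {N : ℕ} (v : Tens n N) (a : QT hR) :
    relET hR (v ⊗ₜ a) = ∑ α, v α • ((a : QMinus hR) * monoE hR α) := by
  simp [relET]

variable (R) in
/-- `[N!]_B` acting on `V`: `(Mω)^{[γ]} = M^{[γ]}_{[α]} ω^{[α]}`. -/
def factE (N : ℕ) : Tens n N →ₗ[ℂ] Tens n N := (braidedFactorial (braid R) N).mulVecLin

variable (R) in
/-- `[N!]_B` acting on row tensors: `(ηM)_{[α]} = η_{[γ]} M^{[γ]}_{[α]}`. -/
def factF (N : ℕ) : Tens n N →ₗ[ℂ] Tens n N := (braidedFactorial (braid R) N).vecMulLinear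

/-- `[N!]_B : V ⊗ Y₋(T) → V ⊗ Y₋(T)`. -/
def factET (N : ℕ) : Tens n N ⊗[ℂ] QT hR →ₗ[ℂ] Tens n N ⊗[ℂ] QT hR :=
  (factE R N).rTensor (QT hR)

/-- The `T`-independent relators `E_{[α]} ω^{[α]}` with `[N!]_B ω = 0`. -/
def serreE : Set (QMinus hR) := {y | ∃ (N : ℕ) (ω : Tens n N), factE R N ω = 0 ∧ y = relE hR ω}

/-- The relators `η_{[α]} F^{[α]}` with `η [N!]_B = 0`. -/
def serreF : Set (QPlus hR) := {x | ∃ (N : ℕ) (η : Tens n N), factF R N η = 0 ∧ x = relF hR η}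

/-- The `T`-dependent relators `ω^{[α]}(T) E_{[α]}` with `[N!]_B ω(T) = 0`. -/
def serreET : Set (QMinus hR) :=
  {y | ∃ (N : ℕ) (ω : Tens n N ⊗[ℂ] QT hR), factET hR N ω = 0 ∧ y = relET hR ω}

end ent

end Pairing

end YBAlg

end

namespace YBAlg

/-! ### Recursion for the braided factorial -/

section Matrices

variable {n : ℕ}

/-! Everything reduces to one computation of the pairing on normally ordered products: for `x` in
the subalgebra generated by `U` and `a` in the one generated by `T`, `⟨x F^β, a E_α⟩` equals `⟨x,
a⟩` times the entry `([N!]_B)^β_α` when both monomials have length `N`, and vanishes when the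
lengths differ (`pairing_monomials`, `pairing_monomials_of_ne`). Its core is `pairing_prodF_mul_E`:
right multiplication by `E_a` is adjoint to a braided derivation that removes one `F`, with
coefficients the entries of a braided integer. The coproduct `Δ(E_a) = ∑ E_j ⊗ t^j_a + 1 ⊗ E_a` has
two parts. They produce the two terms of the recursion `[N+2]_B = ([N+1]_B ⊗ 1) B_{N+1} + 1`
(`braidedInt_succ`), the matrix `B` coming from `⟨F^b, y t^j_a⟩`.

The exchange relations move every `T` to the left of every `E` and every `U` to the left of every
`F`, so normally ordered products span both algebras, and the formula determines the whole pairing.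
Dividing by `I_±` makes the `U`-`T` pairing non-degenerate almost by definition. Hence `∑ ω^α(T)
E_α` is null exactly when each homogeneous component of its coefficients is killed by `[N!]_B`:
orthogonality of different lengths isolates a component, and non-degeneracy removes the test element
`x`.

The matrix `[N!]_B` is numerical. Expanding the coefficients `ω^α(T)` in a basis of their
finite-dimensional span therefore writes a `T`-dependent relator as a combination of numerical ones
with left coefficients (`sum_mul_mem_of_kernel`). This gives the equality of the relator ideals and,
with normal ordering, the description of the null ideals. The kernel on the tensor product is the
flatness of a complex vector space. -/

theorem onLegs_transpose {N : ℕ} (A : Matrix (Fin n × Fin n) (Fin n × Fin n) ℂ) (i j : Fin N) :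
    (onLegs A i j : MultiMat n N).transpose = onLegs A.transpose i j := by
  ext a b
  simp [onLegs, Matrix.transpose_apply, eq_comm]

/-- Transposition turns `onLegs_mul_apply`, the formula for multiplication on the other side, into
this one. -/
theorem mul_onLegs_apply {N : ℕ} (A : Matrix (Fin n × Fin n) (Fin n × Fin n) ℂ) {i j : Fin N}
    (hij : i ≠ j) (M : MultiMat n N) (a c : Fin N → Fin n) :
    (M * onLegs A i j) a c = ∑ p, ∑ q,
      M a (Function.update (Function.update c i p) j q) * A (p, q) (c i, c j) := by
  rw [← Matrix.transpose_apply (M * onLegs A i j), Matrix.transpose_mul, onLegs_transpose,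
    onLegs_mul_apply _ hij]
  simp [Matrix.transpose_apply, mul_comm]

theorem tensorId_one {N : ℕ} : tensorId (1 : MultiMat n N) = 1 := by
  ext a b
  refine Fin.snocCases (fun a x => ?_) a
  refine Fin.snocCases (fun b y => ?_) b
  simp [tensorId, Matrix.one_apply, Fin.snoc_inj, ite_and, and_comm]

theorem tensorId_mul_apply {N : ℕ} (M : MultiMat n N) (P : MultiMat n (N + 1))
    (a c : Fin (N + 1) → Fin n) :
    (tensorId M * P) a c =
      ∑ g, M (Fin.init a) g * P (Fin.snoc (α := fun _ => Fin n) g (a (Fin.last N))) c := by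
  rw [Matrix.mul_apply, ← (Fin.snocEquiv fun _ => Fin n).sum_comp, Fintype.sum_prod_type]
  simp [tensorId, Fin.snocEquiv]

theorem mul_tensorId_apply {N : ℕ} (M : MultiMat n N) (P : MultiMat n (N + 1))
    (a c : Fin (N + 1) → Fin n) :
    (P * tensorId M) a c =
      ∑ g, P a (Fin.snoc (α := fun _ => Fin n) g (c (Fin.last N))) * M g (Fin.init c) := by
  rw [Matrix.mul_apply, ← (Fin.snocEquiv fun _ => Fin n).sum_comp, Fintype.sum_prod_type]
  simp [tensorId, Fin.snocEquiv]

theorem tensorId_mul {N : ℕ} (M P : MultiMat n N) :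
    tensorId (M * P) = tensorId M * tensorId P := by
  ext a b
  rw [tensorId_mul_apply]
  simp [tensorId, Matrix.mul_apply]

theorem tensorId_sum {N : ℕ} {ι : Type*} (s : Finset ι) (f : ι → MultiMat n N) :
    tensorId (∑ i ∈ s, f i) = ∑ i ∈ s, tensorId (f i) := by
  ext a b
  simp only [tensorId, Matrix.sum_apply]
  split_ifs <;> simp

theorem tensorId_list_prod {N : ℕ} (l : List (MultiMat n N)) :
    tensorId l.prod = (l.map tensorId).prod := by
  induction l with
  | nil => simp [tensorId_one]
  | cons M l ih => simp [tensorId_mul, ih]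

theorem tensorId_onLegs {N : ℕ} (A : Matrix (Fin n × Fin n) (Fin n × Fin n) ℂ) (i j : Fin N) :
    tensorId (onLegs A i j) = onLegs A i.castSucc j.castSucc := by
  ext a b
  simp only [tensorId, onLegs, Fin.forall_fin_succ', Fin.init]
  have h1 : Fin.last N ≠ i.castSucc := (Fin.castSucc_lt_last i).ne'
  have h2 : Fin.last N ≠ j.castSucc := (Fin.castSucc_lt_last j).ne'
  by_cases h : a (Fin.last N) = b (Fin.last N) <;> simp [h, h1, h2]
  congr

theorem braidedInt_zero (B : Matrix (Fin n × Fin n) (Fin n × Fin n) ℂ) : braidedInt B 0 = 1 := by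
  simp [braidedInt]

/-- All summands except the last end in the factor acting on the final two legs; stripping it leaves
the previous braided integer on the first legs. The last summand is the empty product. With the
index shift, `braidedInt B N` is `[N+1]_B`. -/
theorem braidedInt_succ (B : Matrix (Fin n × Fin n) (Fin n × Fin n) ℂ) (N : ℕ) :
    braidedInt B (N + 1) = tensorId (braidedInt B N) *
      onLegs B (Fin.last N).castSucc (Fin.last (N + 1)) + 1 := by
  rw [braidedInt, Fin.sum_univ_castSucc, braidedInt, tensorId_sum, Finset.sum_mul]
  congr 1
  · refine Finset.sum_congr rfl fun k _ => ?_
    rw [tensorId_list_prod, List.finRange_succ_last, List.drop_append_of_le_length (by simp; omega)]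
    simp [List.map_drop, tensorId_onLegs, Function.comp_def]
  · rw [List.drop_eq_nil_of_le (by simp)]
    simp

/-- The flip in `braid` turns the last factor into `R (b, j) (c, a)`, the coefficient that
`pairing_F_mul_t` produces. -/
theorem braidedInt_succ_apply (R : Matrix (Fin n × Fin n) (Fin n × Fin n) ℂ) (N : ℕ)
    (β : Fin (N + 1) → Fin n) (γ : Fin N → Fin n) (b c a : Fin n) :
    braidedInt (braid R) (N + 1) (Fin.snoc (α := fun _ => Fin n) β b)
        (Fin.snoc (α := fun _ => Fin n) (Fin.snoc (α := fun _ => Fin n) γ c) a) =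
      (∑ j, braidedInt (braid R) N β (Fin.snoc (α := fun _ => Fin n) γ j) * R (b, j) (c, a)) +
        if b = a ∧ β = Fin.snoc (α := fun _ => Fin n) γ c then 1 else 0 := by
  have hne : (Fin.last N).castSucc ≠ Fin.last (N + 1) := (Fin.castSucc_lt_last _).ne
  rw [braidedInt_succ, Matrix.add_apply, mul_onLegs_apply _ hne]
  congr 1
  · simp [tensorId, braid, ← Fin.snoc_update, Fin.update_snoc_last]
  · simp [Matrix.one_apply, Fin.snoc_inj, and_comm]

end Matrices

/-! ### The pairing of monomials -/

section Monomials

variable {n : ℕ} {R : Matrix (Fin n × Fin n) (Fin n × Fin n) ℂ}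

theorem prod_ofFn_snoc {A : Type*} [Monoid A] (f : Fin n → A) {N : ℕ} (α : Fin N → Fin n)
    (a : Fin n) :
    (List.ofFn fun i => f (Fin.snoc (α := fun _ => Fin n) α a i)).prod =
      (List.ofFn fun i => f (α i)).prod * f a := by
  rw [List.ofFn_succ']
  simp

variable (hR : YangBaxter R)

/-- Pairing with `F^b` is an entry of the last column of a block triangular antirepresentation, so
pairings of `F^b` with products are matrix products. -/
theorem pairing_F (b : Fin n) (y : YMinus R) : pairing hR (F R b) y = ent hR (some b) none y := by
  simp [pairing, pairingHom, entConv]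

theorem pairing_F_mul_E (b a : Fin n) (y : YMinus R) :
    pairing hR (F R b) (y * E R a) = if b = a then Coalgebra.counit (R := ℂ) y else 0 := by
  simp [pairing_F, ent_mul, Fintype.sum_option, evalE]

theorem pairing_F_mul_t (b j a : Fin n) (y : YMinus R) :
    pairing hR (F R b) (y * t R j a) = ∑ c, R (b, j) (c, a) * pairing hR (F R c) y := by
  simp [pairing_F, ent_mul, Fintype.sum_option, evalT]

/-- The two terms come from the two parts of `Δ(E_a)`. The first still has an `E_j` facing `z`,
which is what lets an induction on the number of `F`s continue. -/
theorem pairing_mul_F_mul_E (z : YPlus R) (y : YMinus R) (a b : Fin n) {ι : Type*}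
    (r : Coalgebra.Repr ℂ y ι) :
    pairing hR (z * F R b) (y * E R a) =
      ∑ j, ∑ c, R (b, j) (c, a) *
        (∑ i ∈ r.index, pairing hR z (r.left i * E R j) * pairing hR (F R c) (r.right i)) +
      if b = a then pairing hR z y else 0 := by
  have h : ∑ i ∈ r.index, pairing hR z (r.left i) * Coalgebra.counit (R := ℂ) (r.right i) =
      pairing hR z y := by
    -- The counit axiom for `y` is obtained by splitting `z * 1`, since `⟨1, ·⟩ = ε`.
    rw [← mul_one z, pairing_mul_left, pairing₂Left_repr hR _ _ y r]
    simp [pairing_one_left]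
  rw [pairing_mul_left, Bialgebra.comul_mul, comul_E, ← r.eq]
  simp only [pairing₂Left, mul_add, Finset.mul_sum, Finset.sum_mul, Algebra.TensorProduct.tmul_mul_tmul,
    map_add, map_sum, LinearMap.comp_apply, TensorProduct.map_tmul, LinearMap.mul'_apply,
    pairing_F_mul_t, mul_one, pairing_F_mul_E]
  congr 1
  · refine Finset.sum_congr rfl fun j _ => ?_
    rw [Finset.sum_comm]
    refine Finset.sum_congr rfl fun c _ => Finset.sum_congr rfl fun i _ => ?_
    ring
  · split_ifs
    · exact h
    · simp

/-- The projections killing `E` and `F` are adjoint to each other and fix the `T` and `U`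
subalgebras, so an element of `subU R` only sees the part of `y` free of `E`. -/
theorem pairing_eq_zero_of_projT {x : YPlus R} (hx : x ∈ subU R) {y : YMinus R}
    (hy : projT R y = 0) : pairing hR x y = 0 := by
  rw [← projU_of_mem hx, ← pairing_proj, hy, map_zero]

theorem pairing_eq_zero_of_projU {x : YPlus R} {y : YMinus R} (hy : y ∈ subT R)
    (hx : projU R x = 0) : pairing hR x y = 0 := by
  rw [← projT_of_mem hy, pairing_proj, hx, map_zero, LinearMap.zero_apply]

@[simp] theorem projT_E (i : Fin n) : projT R (E R i) = 0 := by simp [projT]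

@[simp] theorem projU_F (i : Fin n) : projU R (F R i) = 0 := by simp [projU]

variable (R) in
/-- The monomial `E_{α₁} ⋯ E_{α_N}` in `Y₋`. -/
def prodE {N : ℕ} (α : Fin N → Fin n) : YMinus R := (List.ofFn fun i => E R (α i)).prod

variable (R) in
/-- The monomial `F^{α₁} ⋯ F^{α_N}` in `Y₊`. -/
def prodF {N : ℕ} (α : Fin N → Fin n) : YPlus R := (List.ofFn fun i => F R (α i)).prod

theorem prodE_snoc {N : ℕ} (α : Fin N → Fin n) (a : Fin n) :
    prodE R (Fin.snoc (α := fun _ => Fin n) α a) = prodE R α * E R a := prod_ofFn_snoc _ _ _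

theorem prodF_snoc {N : ℕ} (α : Fin N → Fin n) (a : Fin n) :
    prodF R (Fin.snoc (α := fun _ => Fin n) α a) = prodF R α * F R a := prod_ofFn_snoc _ _ _

@[simp] theorem prodE_zero (α : Fin 0 → Fin n) : prodE R α = 1 := by simp [prodE]

@[simp] theorem prodF_zero (α : Fin 0 → Fin n) : prodF R α = 1 := by simp [prodF]

/-- Right multiplication by `E_a` is adjoint to the braided derivation on monomials in `F`. -/
theorem pairing_prodF_mul_E {x : YPlus R} (hx : x ∈ subU R) (a : Fin n) (N : ℕ)
    (β : Fin (N + 1) → Fin n) (y : YMinus R) :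
    pairing hR (x * prodF R β) (y * E R a) =
      ∑ γ : Fin N → Fin n, braidedInt (braid R) N β (Fin.snoc (α := fun _ => Fin n) γ a) *
        pairing hR (x * prodF R γ) y := by
  induction N generalizing a y with
  | zero =>
    refine Fin.snocCases (fun β b => ?_) β
    rw [prodF_snoc, prodF_zero, one_mul,
      pairing_mul_F_mul_E hR x y a b (Coalgebra.Repr.arbitrary ℂ y)]
    -- No `F` remains on the left, so only the counit term of `pairing_mul_F_mul_E` survives.
    have h (z : YMinus R) (j : Fin n) : pairing hR x (z * E R j) = 0 :=
      pairing_eq_zero_of_projT hR hx (by simp)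
    simp [h, braidedInt_zero, Matrix.one_apply, Fin.snoc_inj, eq_iff_true_of_subsingleton]
  | succ N ih =>
    refine Fin.snocCases (fun β b => ?_) β
    let r := Coalgebra.Repr.arbitrary ℂ y
    -- The induction hypothesis is applied to the left Sweedler factors of `y`, hence the
    -- generalization over `y`. The coproduct is then reabsorbed, which attaches `F^c` to `F^γ`.
    have h (c j : Fin n) :
        ∑ i ∈ r.index, pairing hR (x * prodF R β) (r.left i * E R j) *
            pairing hR (F R c) (r.right i) =
          ∑ γ : Fin N → Fin n, braidedInt (braid R) N β (Fin.snoc (α := fun _ => Fin n) γ j) *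
            pairing hR (x * prodF R (Fin.snoc (α := fun _ => Fin n) γ c)) y := by
      simp only [ih, Finset.sum_mul]
      rw [Finset.sum_comm]
      refine Finset.sum_congr rfl fun γ _ => ?_
      rw [prodF_snoc, ← mul_assoc x, pairing_mul_left hR (x * prodF R γ),
        pairing₂Left_repr hR _ _ y r, Finset.mul_sum]
      simp only [mul_assoc]
    rw [prodF_snoc, ← mul_assoc, pairing_mul_F_mul_E hR _ y a b r]
    simp only [h]
    rw [← (Fin.snocEquiv fun _ => Fin n).sum_comp, Fintype.sum_prod_type]
    simp only [Fin.snocEquiv, Equiv.coe_fn_mk, braidedInt_succ_apply, add_mul,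
      Finset.sum_add_distrib]
    congr 1
    · rw [Finset.sum_comm]
      refine Finset.sum_congr rfl fun c _ => ?_
      simp only [Finset.sum_mul, Finset.mul_sum]
      rw [Finset.sum_comm]
      refine Finset.sum_congr rfl fun γ _ => Finset.sum_congr rfl fun j _ => ?_
      ring
    -- The identity summand of the braided integer: the pairs `(c, γ)` run over all multi-indices of
    -- length `N + 1`, and the delta selects `β`.
    · rw [← Fintype.sum_prod_type' (f := fun (c : Fin n) (γ : Fin N → Fin n) =>
        (if b = a ∧ β = Fin.snoc (α := fun _ => Fin n) γ c then (1 : ℂ) else 0) *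
          pairing hR (x * prodF R (Fin.snoc (α := fun _ => Fin n) γ c)) y)]
      refine Eq.trans ?_ ((Fin.snocEquiv fun _ => Fin n).sum_comp
        (fun δ : Fin (N + 1) → Fin n => (if b = a ∧ β = δ then (1 : ℂ) else 0) *
          pairing hR (x * prodF R δ) y)).symm
      by_cases hab : b = a <;> simp [hab]

theorem braidedFactorial_succ_apply (N : ℕ) (β α : Fin (N + 1) → Fin n) :
    braidedFactorial (braid R) (N + 1) β α =
      ∑ γ, braidedInt (braid R) N β (Fin.snoc (α := fun _ => Fin n) γ (α (Fin.last N))) *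
        braidedFactorial (braid R) N γ (Fin.init α) := by
  rw [braidedFactorial, mul_tensorId_apply]

/-- Removing the `E`s from the right, one braided derivation at a time, composes braided integers in
the same order as the recursion of the factorial. -/
theorem pairing_monomials {x : YPlus R} (hx : x ∈ subU R) (a : YMinus R)
    (N : ℕ) (β α : Fin N → Fin n) :
    pairing hR (x * prodF R β) (a * prodE R α) =
      pairing hR x a * braidedFactorial (braid R) N β α := by
  induction N with
  | zero => simp [braidedFactorial, Matrix.one_apply, eq_iff_true_of_subsingleton]
  | succ N ih =>
    rw [braidedFactorial_succ_apply]
    refine Fin.snocCases (fun α i => ?_) α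
    rw [prodE_snoc, ← mul_assoc, pairing_prodF_mul_E hR hx, Finset.mul_sum]
    simp only [ih, Fin.snoc_last, Fin.init_snoc]
    refine Finset.sum_congr rfl fun γ _ => ?_
    ring

/-- Each `E` cancels one `F` until one kind runs out; the letters left over face a pure `T` or pure
`U` element and are killed by a projection. -/
theorem pairing_monomials_of_ne {x : YPlus R} (hx : x ∈ subU R) {a : YMinus R}
    (ha : a ∈ subT R) {M N : ℕ} (hMN : M ≠ N) (β : Fin M → Fin n) (α : Fin N → Fin n) :
    pairing hR (x * prodF R β) (a * prodE R α) = 0 := by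
  induction N generalizing M with
  | zero =>
    obtain ⟨M, rfl⟩ := Nat.exists_eq_succ_of_ne_zero hMN
    refine Fin.snocCases (fun β i => ?_) β
    rw [prodE_zero, mul_one, prodF_snoc]
    exact pairing_eq_zero_of_projU hR ha (by simp)
  | succ N ih =>
    refine Fin.snocCases (fun α i => ?_) α
    rw [prodE_snoc, ← mul_assoc]
    cases M with
    | zero =>
      rw [prodF_zero, mul_one]
      exact pairing_eq_zero_of_projT hR hx (by simp)
    | succ M =>
      rw [pairing_prodF_mul_E hR hx]
      exact Finset.sum_eq_zero fun γ _ => by rw [ih (by omega), mul_zero]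

end Monomials

/-! ### Normal ordering -/

section NormalOrder

variable {n : ℕ} {A : Type*} [Ring A] [Algebra ℂ A]

/-- The span of the normally ordered products `a f_{α₁} ⋯ f_{α_N}` with `a ∈ S`. -/
def normalSpan (S : Subalgebra ℂ A) (f : Fin n → A) : Submodule ℂ A :=
  Submodule.span ℂ {y | ∃ a ∈ S, ∃ (N : ℕ) (α : Fin N → Fin n),
    y = a * (List.ofFn fun i => f (α i)).prod}

theorem mul_mem_normalSpan {S : Subalgebra ℂ A} {f : Fin n → A} {y : A}
    (hy : y ∈ normalSpan S f) (i : Fin n) : y * f i ∈ normalSpan S f := by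
  induction hy using Submodule.span_induction with
  | mem y hy =>
    obtain ⟨a, ha, N, α, rfl⟩ := hy
    refine Submodule.subset_span ⟨a, ha, N + 1, Fin.snoc (α := fun _ => Fin n) α i, ?_⟩
    rw [prod_ofFn_snoc, mul_assoc]
  | zero => simp
  | add x y _ _ hx hy => rw [add_mul]; exact add_mem hx hy
  | smul c x _ hx => rw [smul_mul_assoc]; exact Submodule.smul_mem _ _ hx

/-- A generator travels left past the `f`s one at a time. It may change into other members of `T` on
the way, so the induction on the length is over all `s` at once. -/
theorem mul_mem_normalSpan_of_exchange {S : Subalgebra ℂ A} {f : Fin n → A} {T : Set A}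
    (hT : T ⊆ S)
    (h : ∀ i, ∀ s ∈ T, f i * s ∈ Submodule.span ℂ {y | ∃ s' ∈ T, ∃ j, y = s' * f j})
    {y : A} (hy : y ∈ normalSpan S f) {s : A} (hs : s ∈ T) : y * s ∈ normalSpan S f := by
  induction hy using Submodule.span_induction with
  | mem y hy =>
    obtain ⟨a, ha, N, α, rfl⟩ := hy
    induction N generalizing s with
    | zero => exact Submodule.subset_span ⟨a * s, mul_mem ha (hT hs), 0, α, by simp⟩
    | succ N ih =>
      refine Fin.snocCases (fun α i => ?_) α
      rw [prod_ofFn_snoc, ← mul_assoc, mul_assoc _ (f i)]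
      have hmem := h i s hs
      -- Only membership of this product in the span matters, and forgetting its form allows span
      -- induction.
      generalize f i * s = w at hmem ⊢
      induction hmem using Submodule.span_induction with
      | mem z hz =>
        obtain ⟨s', hs', j, rfl⟩ := hz
        rw [← mul_assoc]
        exact mul_mem_normalSpan (ih hs' α) j
      | zero => simp
      | add x y _ _ hx hy => rw [mul_add]; exact add_mem hx hy
      | smul c x _ hx => rw [mul_smul_comm]; exact Submodule.smul_mem _ _ hx
  | zero => simp
  | add x y _ _ hx hy => rw [add_mul]; exact add_mem hx hy
  | smul c x _ hx => rw [smul_mul_assoc]; exact Submodule.smul_mem _ _ hx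

theorem one_mem_normalSpan (S : Subalgebra ℂ A) (f : Fin n → A) : 1 ∈ normalSpan S f :=
  Submodule.subset_span ⟨1, one_mem S, 0, Fin.elim0, by simp⟩

/-- Elements of the normal span are finite sums of normally ordered products. -/
theorem exists_eq_sum_of_mem_normalSpan {S : Subalgebra ℂ A} {f : Fin n → A} {y : A}
    (hy : y ∈ normalSpan S f) :
    ∃ (s : Finset ℕ) (ω : (N : ℕ) → (Fin N → Fin n) → S),
      y = ∑ N ∈ s, ∑ α, (ω N α : A) * (List.ofFn fun i => f (α i)).prod := by
  classical
  induction hy using Submodule.span_induction with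
  | mem y hy =>
    obtain ⟨a, ha, N, α, rfl⟩ := hy
    -- The family supported on the single index `α`; the cast compares multi-indices whose lengths
    -- agree only propositionally.
    refine ⟨{N}, fun M β => if h : ∃ e : M = N, β = α ∘ Fin.cast e then ⟨a, ha⟩ else 0, ?_⟩
    rw [Finset.sum_singleton, Finset.sum_eq_single α]
    · simp
    · intro β _ hβ
      simp [hβ]
    · simp
  | zero => exact ⟨∅, 0, by simp⟩
  | add x y _ _ hx hy =>
    obtain ⟨s, ω, rfl⟩ := hx
    obtain ⟨t, η, rfl⟩ := hy
    -- Each family is cut off outside its own index set, since its values there are arbitrary and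
    -- would contribute to the sum over the union.
    refine ⟨s ∪ t, fun N α => (if N ∈ s then ω N α else 0) + (if N ∈ t then η N α else 0), ?_⟩
    simp only [Subalgebra.coe_add, add_mul, Finset.sum_add_distrib]
    congr 1
    · rw [← Finset.sum_subset Finset.subset_union_left]
      · exact Finset.sum_congr rfl fun N hN => by simp [hN]
      · intro N _ hN; simp [hN]
    · rw [← Finset.sum_subset Finset.subset_union_right]
      · exact Finset.sum_congr rfl fun N hN => by simp [hN]
      · intro N _ hN; simp [hN]
  | smul c x _ hx =>
    obtain ⟨s, ω, rfl⟩ := hx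
    refine ⟨s, fun N α => c • ω N α, ?_⟩
    simp [Finset.smul_sum]

/-- A family in the kernel of a numerical matrix is a combination of numerical kernel vectors. -/
theorem sum_mul_mem_of_kernel {ι κ W : Type*} [Fintype ι] [AddCommGroup W] [Module ℂ W]
    (M : Matrix κ ι ℂ) (φ : W →ₗ[ℂ] A) (I : TwoSidedIdeal A) (ω : ι → W)
    (hω : ∀ β, ∑ α, M β α • ω α = 0) (m : ι → A)
    (hm : ∀ v : ι → ℂ, M.mulVec v = 0 → ∑ α, v α • m α ∈ I) : ∑ α, φ (ω α) * m α ∈ I := by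
  -- `W` may be infinite-dimensional, but finitely many coefficients span a space with a finite
  -- basis.
  let W' := Submodule.span ℂ (Set.range ω)
  have : FiniteDimensional ℂ W' := FiniteDimensional.span_of_finite ℂ (Set.finite_range ω)
  let b := Module.finBasis ℂ W'
  let η : ι → W' := fun α => ⟨ω α, Submodule.subset_span ⟨α, rfl⟩⟩
  have hη (β) : ∑ α, M β α • η α = 0 := by
    apply Subtype.ext
    simpa [η] using hω β
  have h : ∑ α, φ (ω α) * m α = ∑ i, φ (b i) * ∑ α, b.repr (η α) i • m α := by
    have h1 (α) : φ (ω α) = ∑ i, b.repr (η α) i • φ (b i) := by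
      have h2 := congrArg (φ ∘ₗ W'.subtype) (b.sum_repr (η α))
      rw [map_sum] at h2
      simp only [map_smul, LinearMap.comp_apply, Submodule.subtype_apply] at h2
      exact h2.symm
    simp only [h1, Finset.sum_mul, Finset.mul_sum, smul_mul_assoc, mul_smul_comm]
    exact Finset.sum_comm
  rw [h]
  -- The matrix has scalar entries, so it acts on each basis coordinate separately and every
  -- coordinate vector lies in its kernel.
  refine sum_mem fun i _ => I.mul_mem_left _ _ (hm _ ?_)
  ext β
  have := congrArg (fun w => b.repr w i) (hη β)
  simpa [Matrix.mulVec, dotProduct] using this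

end NormalOrder

/-! ### Normal ordering in the quotient algebras -/

section Quotients

variable {n : ℕ} {R : Matrix (Fin n × Fin n) (Fin n × Fin n) ℂ}

theorem mem_normalSpan_minus (y : YMinus R) : y ∈ normalSpan (subT R) (E R) := by
  -- Stability under right multiplication passes to products, whereas membership alone would not.
  suffices h : ∀ z ∈ normalSpan (subT R) (E R), z * y ∈ normalSpan (subT R) (E R) by
    simpa using h 1 (one_mem_normalSpan _ _)
  induction y using minus_induction with
  | hscal c =>
    intro z hz
    rw [← Algebra.commutes, ← Algebra.smul_def]
    exact Submodule.smul_mem _ _ hz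
  | ht i j =>
    intro z hz
    refine mul_mem_normalSpan_of_exchange Algebra.subset_adjoin ?_ hz ⟨(i, j), rfl⟩
    rintro i _ ⟨⟨k, j⟩, rfl⟩
    rw [E_rel]
    exact sum_mem fun p _ => sum_mem fun l _ => Submodule.smul_mem _ _
      (Submodule.subset_span ⟨_, ⟨(k, l), rfl⟩, p, rfl⟩)
  | hE i => exact fun z hz => mul_mem_normalSpan hz i
  | hadd x y hx hy => intro z hz; rw [mul_add]; exact add_mem (hx z hz) (hy z hz)
  | hmul x y hx hy => intro z hz; rw [← mul_assoc]; exact hy _ (hx z hz)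

theorem mem_normalSpan_plus (x : YPlus R) : x ∈ normalSpan (subU R) (F R) := by
  suffices h : ∀ z ∈ normalSpan (subU R) (F R), z * x ∈ normalSpan (subU R) (F R) by
    simpa using h 1 (one_mem_normalSpan _ _)
  induction x using plus_induction with
  | hscal c =>
    intro z hz
    rw [← Algebra.commutes, ← Algebra.smul_def]
    exact Submodule.smul_mem _ _ hz
  | hu i j =>
    intro z hz
    refine mul_mem_normalSpan_of_exchange Algebra.subset_adjoin ?_ hz ⟨(i, j), rfl⟩
    rintro b _ ⟨⟨a, c⟩, rfl⟩
    rw [F_rel]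
    exact sum_mem fun p _ => sum_mem fun q _ => Submodule.smul_mem _ _
      (Submodule.subset_span ⟨_, ⟨(p, c), rfl⟩, q, rfl⟩)
  | hF i => exact fun z hz => mul_mem_normalSpan hz i
  | hadd x y hx hy => intro z hz; rw [mul_add]; exact add_mem (hx z hz) (hy z hz)
  | hmul x y hx hy => intro z hz; rw [← mul_assoc]; exact hy _ (hx z hz)

variable (hR : YangBaxter R)

theorem QT_eq_map : QT hR = (subT R).map (toQMinus hR) := by
  rw [subT, AlgHom.map_adjoin, ← Set.range_comp]
  rfl

theorem QU_eq_map : QU hR = (subU R).map (toQPlus hR) := by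
  rw [subU, AlgHom.map_adjoin, ← Set.range_comp]
  rfl

theorem toQMinus_prodE {N : ℕ} (α : Fin N → Fin n) : toQMinus hR (prodE R α) = monoE hR α := by
  simp [prodE, monoE, map_list_prod, List.map_ofFn, Function.comp_def]

theorem toQPlus_prodF {N : ℕ} (α : Fin N → Fin n) : toQPlus hR (prodF R α) = monoF hR α := by
  simp [prodF, monoF, map_list_prod, List.map_ofFn, Function.comp_def]

theorem exists_eq_sum_monoE (y : QMinus hR) :
    ∃ (s : Finset ℕ) (ω : (N : ℕ) → (Fin N → Fin n) → QT hR),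
      y = ∑ N ∈ s, ∑ α, (ω N α : QMinus hR) * monoE hR α := by
  obtain ⟨y, rfl⟩ := toQMinus_surjective hR y
  obtain ⟨s, ω, rfl⟩ := exists_eq_sum_of_mem_normalSpan (mem_normalSpan_minus y)
  refine ⟨s, fun N α => ⟨toQMinus hR (ω N α), ?_⟩, ?_⟩
  · rw [QT_eq_map]
    exact ⟨_, (ω N α).2, rfl⟩
  · simp only [map_sum, map_mul, ← toQMinus_prodE]
    rfl

theorem exists_eq_sum_monoF (x : QPlus hR) :
    ∃ (s : Finset ℕ) (η : (N : ℕ) → (Fin N → Fin n) → QU hR),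
      x = ∑ N ∈ s, ∑ β, (η N β : QPlus hR) * monoF hR β := by
  obtain ⟨x, rfl⟩ := toQPlus_surjective hR x
  obtain ⟨s, η, rfl⟩ := exists_eq_sum_of_mem_normalSpan (mem_normalSpan_plus x)
  refine ⟨s, fun N β => ⟨toQPlus hR (η N β), ?_⟩, ?_⟩
  · rw [QU_eq_map]
    exact ⟨_, (η N β).2, rfl⟩
  · simp only [map_sum, map_mul, ← toQPlus_prodF]
    rfl

/-! ### The induced pairing on normally ordered products and its non-degeneracy -/

theorem pairingQ_monomials {x : QPlus hR} (hx : x ∈ QU hR) {a : QMinus hR} (ha : a ∈ QT hR)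
    {N : ℕ} (β α : Fin N → Fin n) :
    pairingQ hR (x * monoF hR β) (a * monoE hR α) =
      pairingQ hR x a * braidedFactorial (braid R) N β α := by
  rw [QU_eq_map] at hx
  rw [QT_eq_map] at ha
  obtain ⟨x, hx, rfl⟩ := hx
  obtain ⟨a, ha, rfl⟩ := ha
  have := pairing_monomials hR hx a N β α
  rw [← pairingQ_apply, ← pairingQ_apply, map_mul (toQPlus hR), map_mul (toQMinus hR), toQPlus_prodF, toQMinus_prodE] at this
  exact this

theorem pairingQ_monomials_of_ne {x : QPlus hR} (hx : x ∈ QU hR) {a : QMinus hR}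
    (ha : a ∈ QT hR) {M N : ℕ} (hMN : M ≠ N) (β : Fin M → Fin n) (α : Fin N → Fin n) :
    pairingQ hR (x * monoF hR β) (a * monoE hR α) = 0 := by
  rw [QU_eq_map] at hx
  rw [QT_eq_map] at ha
  obtain ⟨x, hx, rfl⟩ := hx
  obtain ⟨a, ha, rfl⟩ := ha
  have := pairing_monomials_of_ne hR hx ha hMN β α
  rw [← pairingQ_apply, map_mul (toQPlus hR), map_mul (toQMinus hR), toQPlus_prodF, toQMinus_prodE] at this
  exact this

/-- A lift to the `T` subalgebra pairs to zero with the `U` subalgebra, so it is one of the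
generators of the ideal divided out. -/
theorem eq_zero_of_pairingQ_QU {a : QMinus hR} (ha : a ∈ QT hR)
    (h : ∀ x ∈ QU hR, pairingQ hR x a = 0) : a = 0 := by
  rw [QT_eq_map] at ha
  obtain ⟨a, ha, rfl⟩ := ha
  refine (toQMinus_eq_zero hR).2 (TwoSidedIdeal.subset_span ⟨ha, fun x hx => ?_⟩)
  rw [← pairingQ_apply]
  exact h _ (by rw [QU_eq_map]; exact ⟨x, hx, rfl⟩)

theorem eq_zero_of_pairingQ_QT {x : QPlus hR} (hx : x ∈ QU hR)
    (h : ∀ a ∈ QT hR, pairingQ hR x a = 0) : x = 0 := by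
  rw [QU_eq_map] at hx
  obtain ⟨x, hx, rfl⟩ := hx
  refine (toQPlus_eq_zero hR).2 (TwoSidedIdeal.subset_span ⟨hx, fun a ha => ?_⟩)
  rw [← pairingQ_apply]
  exact h _ (by rw [QT_eq_map]; exact ⟨a, ha, rfl⟩)

/-! ### The null spaces are two-sided ideals -/

theorem mem_nullMinus {y : QMinus hR} : y ∈ nullMinus hR ↔ ∀ x, pairingQ hR x y = 0 := by
  simp [nullMinus, LinearMap.ext_iff]

theorem mem_nullPlus {x : QPlus hR} : x ∈ nullPlus hR ↔ ∀ y, pairingQ hR x y = 0 := by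
  simp [nullPlus, LinearMap.ext_iff]

/-- A product on the right is paired through the coproduct on the left, so every term contains a
factor pairing `y` with something. -/
theorem mul_mem_nullMinus (z : QMinus hR) {y : QMinus hR} (hy : y ∈ nullMinus hR) :
    z * y ∈ nullMinus hR ∧ y * z ∈ nullMinus hR := by
  obtain ⟨y, rfl⟩ := toQMinus_surjective hR y
  obtain ⟨z, rfl⟩ := toQMinus_surjective hR z
  have hy' (x : YPlus R) : pairing hR x y = 0 := by
    rw [← pairingQ_apply]; exact (mem_nullMinus hR).1 hy _
  constructor <;> refine (mem_nullMinus hR).2 fun x => ?_ <;>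
    obtain ⟨x, rfl⟩ := toQPlus_surjective hR x <;>
    rw [← map_mul, pairingQ_apply, pairing_mul_right,
      pairing₂Right_repr hR _ _ x (Coalgebra.Repr.arbitrary ℂ x)] <;>
    simp [hy']

theorem mul_mem_nullPlus (z : QPlus hR) {x : QPlus hR} (hx : x ∈ nullPlus hR) :
    z * x ∈ nullPlus hR ∧ x * z ∈ nullPlus hR := by
  obtain ⟨x, rfl⟩ := toQPlus_surjective hR x
  obtain ⟨z, rfl⟩ := toQPlus_surjective hR z
  have hx' (y : YMinus R) : pairing hR x y = 0 := by
    rw [← pairingQ_apply]; exact (mem_nullPlus hR).1 hx _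
  constructor <;> refine (mem_nullPlus hR).2 fun y => ?_ <;>
    obtain ⟨y, rfl⟩ := toQMinus_surjective hR y <;>
    rw [← map_mul, pairingQ_apply, pairing_mul_left,
      pairing₂Left_repr hR _ _ y (Coalgebra.Repr.arbitrary ℂ y)] <;>
    simp [hx']

/-! ### The null ideals -/

theorem pairingQ_sum_monoE {x : QPlus hR} (hx : x ∈ QU hR) {N : ℕ} (β : Fin N → Fin n)
    (ω : (Fin N → Fin n) → QT hR) :
    pairingQ hR (x * monoF hR β) (∑ α, (ω α : QMinus hR) * monoE hR α) =
      pairingQ hR x (∑ α, braidedFactorial (braid R) N β α • (ω α : QMinus hR)) := by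
  simp [pairingQ_monomials hR hx, mul_comm]

theorem pairingQ_sum_monoF {a : QMinus hR} (ha : a ∈ QT hR) {N : ℕ} (α : Fin N → Fin n)
    (η : (Fin N → Fin n) → QU hR) :
    pairingQ hR (∑ β, (η β : QPlus hR) * monoF hR β) (a * monoE hR α) =
      pairingQ hR (∑ β, braidedFactorial (braid R) N β α • (η β : QPlus hR)) a := by
  simp [pairingQ_monomials hR _ ha, mul_comm]

/-- The test elements `x F^β` with `x` in `QU hR` see only length `N` and return `⟨x, ([N!]_B
ω)^β⟩`; non-degeneracy then gives the vanishing. -/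
theorem factorial_kernel_of_mem_nullMinus {s : Finset ℕ} {ω : (N : ℕ) → (Fin N → Fin n) → QT hR}
    (h : ∑ N ∈ s, ∑ α, (ω N α : QMinus hR) * monoE hR α ∈ nullMinus hR) {N : ℕ} (hN : N ∈ s)
    (β : Fin N → Fin n) : ∑ α, braidedFactorial (braid R) N β α • ω N α = 0 := by
  apply Subtype.ext
  refine eq_zero_of_pairingQ_QU hR (Subtype.property _) fun x hx => ?_
  have h1 := (mem_nullMinus hR).1 h (x * monoF hR β)
  rw [map_sum, Finset.sum_eq_single_of_mem N hN, pairingQ_sum_monoE hR hx] at h1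
  · simpa using h1
  · intro M _ hM
    rw [map_sum]
    exact Finset.sum_eq_zero fun α _ =>
      pairingQ_monomials_of_ne hR hx (Subtype.property _) hM.symm β α

theorem factorial_kernel_of_mem_nullPlus {s : Finset ℕ} {η : (N : ℕ) → (Fin N → Fin n) → QU hR}
    (h : ∑ N ∈ s, ∑ β, (η N β : QPlus hR) * monoF hR β ∈ nullPlus hR) {N : ℕ} (hN : N ∈ s)
    (α : Fin N → Fin n) : ∑ β, braidedFactorial (braid R) N β α • η N β = 0 := by
  apply Subtype.ext
  refine eq_zero_of_pairingQ_QT hR (Subtype.property _) fun a ha => ?_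
  have h1 := (mem_nullPlus hR).1 h (a * monoE hR α)
  rw [map_sum, LinearMap.sum_apply, Finset.sum_eq_single_of_mem N hN,
    pairingQ_sum_monoF hR ha] at h1
  · simpa using h1
  · intro M _ hM
    rw [map_sum, LinearMap.sum_apply]
    exact Finset.sum_eq_zero fun β _ =>
      pairingQ_monomials_of_ne hR (Subtype.property _) ha hM β α

/-- By normal ordering it suffices to test against products `x F^β`: equal lengths produce the
factorial applied to `ω`, unequal lengths produce zero. -/
theorem sum_monoE_mem_nullMinus {N : ℕ} {ω : (Fin N → Fin n) → QT hR}
    (h : ∀ β, ∑ α, braidedFactorial (braid R) N β α • ω α = 0) :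
    ∑ α, (ω α : QMinus hR) * monoE hR α ∈ nullMinus hR := by
  refine (mem_nullMinus hR).2 fun x => ?_
  obtain ⟨s, η, rfl⟩ := exists_eq_sum_monoF hR x
  simp only [map_sum _ _ s, LinearMap.sum_apply]
  refine Finset.sum_eq_zero fun M _ => ?_
  rw [map_sum (pairingQ hR), LinearMap.sum_apply]
  refine Finset.sum_eq_zero fun β _ => ?_
  by_cases hM : M = N
  · subst hM
    rw [pairingQ_sum_monoE hR (η M β).2]
    have := congrArg (Subtype.val) (h β)
    simp only [AddSubmonoidClass.coe_finsetSum, Subalgebra.coe_smul, ZeroMemClass.coe_zero] at this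
    rw [this, map_zero]
  · rw [map_sum]
    exact Finset.sum_eq_zero fun α _ =>
      pairingQ_monomials_of_ne hR (Subtype.property _) (Subtype.property _) hM β α

theorem sum_monoF_mem_nullPlus {N : ℕ} {η : (Fin N → Fin n) → QU hR}
    (h : ∀ α, ∑ β, braidedFactorial (braid R) N β α • η β = 0) :
    ∑ β, (η β : QPlus hR) * monoF hR β ∈ nullPlus hR := by
  refine (mem_nullPlus hR).2 fun y => ?_
  obtain ⟨s, ω, rfl⟩ := exists_eq_sum_monoE hR y
  rw [map_sum]
  refine Finset.sum_eq_zero fun M _ => ?_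
  rw [map_sum]
  refine Finset.sum_eq_zero fun α _ => ?_
  by_cases hM : M = N
  · subst hM
    rw [pairingQ_sum_monoF hR (ω M α).2]
    have := congrArg (Subtype.val) (h α)
    simp only [AddSubmonoidClass.coe_finsetSum, Subalgebra.coe_smul, ZeroMemClass.coe_zero] at this
    rw [this, map_zero, LinearMap.zero_apply]
  · rw [map_sum, LinearMap.sum_apply]
    exact Finset.sum_eq_zero fun β _ =>
      pairingQ_monomials_of_ne hR (Subtype.property _) (Subtype.property _) (Ne.symm hM) β α

/-! ### Reduction to numerical relators -/

theorem sum_monoE_mem_span_serreE {N : ℕ} {ω : (Fin N → Fin n) → QT hR}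
    (h : ∀ β, ∑ α, braidedFactorial (braid R) N β α • ω α = 0) :
    ∑ α, (ω α : QMinus hR) * monoE hR α ∈ TwoSidedIdeal.span (serreE hR) :=
  sum_mul_mem_of_kernel (braidedFactorial (braid R) N) (QT hR).val.toLinearMap _ ω h _
    fun v hv => TwoSidedIdeal.subset_span ⟨N, v, hv, rfl⟩

theorem sum_monoF_mem_span_serreF {N : ℕ} {η : (Fin N → Fin n) → QU hR}
    (h : ∀ α, ∑ β, braidedFactorial (braid R) N β α • η β = 0) :
    ∑ β, (η β : QPlus hR) * monoF hR β ∈ TwoSidedIdeal.span (serreF hR) :=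
  -- The factorial acts on row tensors here, hence the transpose.
  sum_mul_mem_of_kernel (braidedFactorial (braid R) N).transpose (QU hR).val.toLinearMap _ η h _
    fun v hv => TwoSidedIdeal.subset_span ⟨N, v, by
      simpa [factF, Matrix.mulVec_transpose] using hv, rfl⟩

/-- The coordinates `ω^{[α]}(T)` of `ω(T) ∈ V ⊗ Y₋(T)`. -/
noncomputable def coordT (N : ℕ) : Tens n N ⊗[ℂ] QT hR ≃ₗ[ℂ] ((Fin N → Fin n) → QT hR) :=
  TensorProduct.comm ℂ _ _ ≪≫ₗ TensorProduct.piScalarRight ℂ ℂ (QT hR) (Fin N → Fin n)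

@[simp] theorem coordT_tmul {N : ℕ} (v : Tens n N) (a : QT hR) (α : Fin N → Fin n) :
    coordT hR N (v ⊗ₜ a) α = v α • a := by
  simp [coordT]

theorem relET_eq_sum {N : ℕ} (ω : Tens n N ⊗[ℂ] QT hR) :
    relET hR ω = ∑ α, (coordT hR N ω α : QMinus hR) * monoE hR α := by
  induction ω using TensorProduct.induction_on with
  | zero => simp
  | tmul v a => simp [relET_tmul]
  | add x y hx hy => simp [hx, hy, add_mul, Finset.sum_add_distrib]

theorem coordT_factET {N : ℕ} (ω : Tens n N ⊗[ℂ] QT hR) (β : Fin N → Fin n) :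
    coordT hR N (factET hR N ω) β =
      ∑ α, braidedFactorial (braid R) N β α • coordT hR N ω α := by
  induction ω using TensorProduct.induction_on with
  | zero => simp
  | tmul v a =>
    simp [factET, factE, Matrix.mulVec, dotProduct, Finset.sum_smul, mul_smul]
  | add x y hx hy => simp [hx, hy, smul_add, Finset.sum_add_distrib]

theorem factET_eq_zero_iff {N : ℕ} (ω : Tens n N ⊗[ℂ] QT hR) :
    factET hR N ω = 0 ↔ ∀ β, ∑ α, braidedFactorial (braid R) N β α • coordT hR N ω α = 0 := by
  rw [← (coordT hR N).map_eq_zero_iff, funext_iff]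
  simp [coordT_factET]

theorem relET_mem_nullMinus_iff {N : ℕ} (ω : Tens n N ⊗[ℂ] QT hR) :
    relET hR ω ∈ nullMinus hR ↔ factET hR N ω = 0 := by
  rw [factET_eq_zero_iff, relET_eq_sum]
  refine ⟨fun h β => ?_, sum_monoE_mem_nullMinus hR⟩
  classical
  -- The single tensor is extended by zero to all lengths, as the graded kernel lemma requires.
  let η : (M : ℕ) → (Fin M → Fin n) → QT hR := fun M γ =>
    if e : N = M then coordT hR N ω (γ ∘ Fin.cast e) else 0
  have hη : η N = coordT hR N ω := by
    funext γ
    simp [η]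
  have := factorial_kernel_of_mem_nullMinus hR (s := {N}) (ω := η)
    (by rw [Finset.sum_singleton, hη]; exact h) (Finset.mem_singleton_self N) β
  rwa [hη] at this

/-- Tensoring with a flat module preserves exactness of the kernel inclusion followed by the map. -/
theorem ker_factET (N : ℕ) : LinearMap.ker (factET hR N) =
    LinearMap.range ((LinearMap.ker (factE R N)).subtype.rTensor (QT hR)) :=
  LinearMap.exact_iff.1 (Module.Flat.rTensor_exact (QT hR)
    (LinearMap.exact_subtype_ker_map (factE R N)))

theorem relET_tmul_one {N : ℕ} (v : Tens n N) : relET hR (v ⊗ₜ 1) = relE hR v := by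
  simp [relET_tmul, relE]

/-- One inclusion is the expansion of coefficients in a basis; the other views a numerical relator
as `ω ⊗ 1`. -/
theorem span_serreET : TwoSidedIdeal.span (serreET hR) = TwoSidedIdeal.span (serreE hR) := by
  apply le_antisymm
  · rw [TwoSidedIdeal.span_le]
    rintro _ ⟨N, ω, hω, rfl⟩
    rw [relET_eq_sum]
    exact sum_monoE_mem_span_serreE hR ((factET_eq_zero_iff hR ω).1 hω)
  · refine TwoSidedIdeal.span_mono ?_
    rintro _ ⟨N, ω, hω, rfl⟩
    exact ⟨N, ω ⊗ₜ 1, by simp [factET, hω], (relET_tmul_one hR ω).symm⟩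

theorem relE_mem_nullMinus {N : ℕ} {ω : Tens n N} (hω : factE R N ω = 0) :
    relE hR ω ∈ nullMinus hR := by
  rw [← relET_tmul_one, relET_mem_nullMinus_iff]
  simp [factET, hω]

theorem relF_mem_nullPlus {N : ℕ} {η : Tens n N} (hη : factF R N η = 0) :
    relF hR η ∈ nullPlus hR := by
  -- Numerical coefficients are regarded as scalar multiples of the unit of `QU hR`.
  have := sum_monoF_mem_nullPlus hR (N := N) (η := fun β => η β • 1) fun α => by
    have h := congrFun hη α
    simp only [factF, Matrix.vecMulLinear_apply, Matrix.vecMul, dotProduct, Pi.zero_apply] at h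
    simp only [smul_smul, ← Finset.sum_smul, mul_comm, h, zero_smul]
  simpa [relF] using this

/-- Normal ordering splits a null element into homogeneous pieces, each satisfying the factorial
equation and so lying in the relator ideal. Conversely, the relators are null and the null space is
an ideal. -/
theorem mem_nullMinus_iff (y : QMinus hR) :
    y ∈ nullMinus hR ↔ y ∈ TwoSidedIdeal.span (serreE hR) := by
  constructor
  · intro h
    obtain ⟨s, ω, rfl⟩ := exists_eq_sum_monoE hR y
    exact sum_mem fun N hN =>
      sum_monoE_mem_span_serreE hR (factorial_kernel_of_mem_nullMinus hR h hN)
  · intro h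
    induction h using TwoSidedIdeal.span_induction with
    | mem y h => obtain ⟨N, ω, hω, rfl⟩ := h; exact relE_mem_nullMinus hR hω
    | zero => exact zero_mem _
    | add a b _ _ ha hb => exact add_mem ha hb
    | neg a _ ha => exact neg_mem ha
    | left_absorb b a _ ha => exact (mul_mem_nullMinus hR _ ha).1
    | right_absorb b a _ ha => exact (mul_mem_nullMinus hR _ ha).2

theorem mem_nullPlus_iff (x : QPlus hR) :
    x ∈ nullPlus hR ↔ x ∈ TwoSidedIdeal.span (serreF hR) := by
  constructor
  · intro h
    obtain ⟨s, η, rfl⟩ := exists_eq_sum_monoF hR x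
    exact sum_mem fun N hN =>
      sum_monoF_mem_span_serreF hR (factorial_kernel_of_mem_nullPlus hR h hN)
  · intro h
    induction h using TwoSidedIdeal.span_induction with
    | mem x h => obtain ⟨N, η, hη, rfl⟩ := h; exact relF_mem_nullPlus hR hη
    | zero => exact zero_mem _
    | add a b _ _ ha hb => exact add_mem ha hb
    | neg a _ ha => exact neg_mem ha
    | left_absorb b a _ ha => exact (mul_mem_nullPlus hR _ ha).1
    | right_absorb b a _ ha => exact (mul_mem_nullPlus hR _ ha).2

end Quotients

end YBAlg

theorem mainTheorem2 {n : ℕ} (R : Matrix (Fin n × Fin n) (Fin n × Fin n) ℂ)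
    (hinv : IsUnit R) (hR : YBAlg.YangBaxter R) :
    -- the `T`-`U` pairing is non-degenerate after the quotient
    ((∀ a ∈ YBAlg.QT hR, (∀ x ∈ YBAlg.QU hR, YBAlg.pairingQ hR x a = 0) → a = 0) ∧
      (∀ x ∈ YBAlg.QU hR, (∀ a ∈ YBAlg.QT hR, YBAlg.pairingQ hR x a = 0) → x = 0)) ∧
    -- `ω^{[α]}(T) E_{[α]}` lies in the kernel of the pairing iff `[N!]_B ω(T) = 0`
    (∀ (N : ℕ) (ω : YBAlg.Tens n N ⊗[ℂ] YBAlg.QT hR),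
      YBAlg.relET hR ω ∈ YBAlg.nullMinus hR ↔ YBAlg.factET hR N ω = 0) ∧
    -- the kernel of `[N!]_B` on `V ⊗ Y₋(T)` is `K ⊗ Y₋(T)`
    (∀ N : ℕ, LinearMap.ker (YBAlg.factET hR N) =
      LinearMap.range ((LinearMap.ker (YBAlg.factE R N)).subtype.rTensor (YBAlg.QT hR))) ∧
    -- `T`-dependent relators do not enlarge the ideal generated by the `T`-independent ones
    TwoSidedIdeal.span (YBAlg.serreET hR) = TwoSidedIdeal.span (YBAlg.serreE hR) ∧
    -- the null ideals are generated by the `T`- and `U`-independent relators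
    (∀ y : YBAlg.QMinus hR, y ∈ YBAlg.nullMinus hR ↔ y ∈ TwoSidedIdeal.span (YBAlg.serreE hR)) ∧
    (∀ x : YBAlg.QPlus hR, x ∈ YBAlg.nullPlus hR ↔ x ∈ TwoSidedIdeal.span (YBAlg.serreF hR)) := by
  exact ⟨⟨fun _ ha h => YBAlg.eq_zero_of_pairingQ_QU hR ha h,
      fun _ hx h => YBAlg.eq_zero_of_pairingQ_QT hR hx h⟩,
    fun _ ω => YBAlg.relET_mem_nullMinus_iff hR ω, YBAlg.ker_factET hR, YBAlg.span_serreET hR,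
    YBAlg.mem_nullMinus_iff hR, YBAlg.mem_nullPlus_iff hR⟩
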